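/- Let $L=\mathfrak{aff}(\mathbb R)\oplus\mathbb R$, where $\mathfrak{aff}(\mathbb R)$ is the non-abelian two-dimensional real Lie algebra, and let $\mathfrak z$ and $\mathfrak d$ be the center and the derived subalgebra of $L$; both are lines. Let $q$ be a Lorentzian metric on $L$, that is, a nondegenerate symmetric bilinear form of signature $(-,+,+)$. A line is called spacelike, timelike or lightlike if $q(w,w)>0$, $q(w,w)<0$ or $q(w,w)=0$, respectively, for its nonzero vectors $w$. Let $G$ be any Lie group with Lie algebra $L$ (identified with the left-invariant vector fields), and let $g$ be the left-invariant Lorentzian metric on $G$ defined by $q$. We say that $q$ is complete if $(G,g)$ is geodesically complete, that is, if every geodesic of the Levi-Civita connection of $g$ is defined for all times (given any initial point and velocity), and incomplete otherwise. The geodesic field of $q$ is the vector field $F(v)=\operatorname{ad}_v^{\dagger}v$ on $L$, where $\dagger$ is the $q$-transpose, so that $q(F(v),w)=q(v,[v,w])$ for all $w\in L$. An idempotent is a vector $v\neq 0$ with $F(v)=v$. Integral curves are defined on open intervals of $\mathbb R$. Then: (a) if $\mathfrak z$ is spacelike, $q$ is incomplete and its geodesic field has an idempotent; (b) if $\mathfrak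 z$ is timelike, $q$ is complete and all integral curves of the geodesic field are bounded; (c) if $\mathfrak z$ is lightlike (c.1) and $\mathfrak z$ and $\mathfrak d$ are not orthogonal, $q$ is incomplete and its geodesic field has no idempotents; (c.2) and $\mathfrak z$ and $\mathfrak d$ are orthogonal, $q$ is complete and all non-stationary maximal integral curves of the geodesic field are unbounded. -/

import Mathlib

open scoped Manifold ContDiff

noncomputable section

/-! ### The Lie algebra `aff(ℝ) ⊕ ℝ` -/

/-- The Lie algebra `aff(ℝ)` of the affine group of the line. The pair `(a, b)` stands for the
matrix with rows `(a, b)` and `(0, 0)`. -/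
def AffR : Type := ℝ × ℝ

namespace AffR

instance : NormedAddCommGroup AffR := inferInstanceAs (NormedAddCommGroup (ℝ × ℝ))

instance : NormedSpace ℝ AffR := inferInstanceAs (NormedSpace ℝ (ℝ × ℝ))

instance : FiniteDimensional ℝ AffR := inferInstanceAs (FiniteDimensional ℝ (ℝ × ℝ))

/-- The commutator of the matrices with first rows `(a, b)` and `(a', b')`; both second rows
vanish. -/
instance : Bracket AffR AffR := ⟨fun u w => ((0, u.1 * w.2 - w.1 * u.2) : ℝ × ℝ)⟩

@[simp] theorem bracket_fst (u w : AffR) : ⁅u, w⁆.1 = 0 := rfl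

@[simp] theorem bracket_snd (u w : AffR) : ⁅u, w⁆.2 = u.1 * w.2 - w.1 * u.2 := rfl

@[simp] theorem add_fst (u w : AffR) : (u + w).1 = u.1 + w.1 := rfl

@[simp] theorem add_snd (u w : AffR) : (u + w).2 = u.2 + w.2 := rfl

@[simp] theorem smul_fst (c : ℝ) (u : AffR) : (c • u).1 = c * u.1 := rfl

@[simp] theorem smul_snd (c : ℝ) (u : AffR) : (c • u).2 = c * u.2 := rfl

instance : LieRing AffR where
  add_lie u v w := by
    apply Prod.ext <;> simp
    ring
  lie_add u v w := by
    apply Prod.ext <;> simp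
    ring
  lie_self u := by
    apply Prod.ext
    · rfl
    · exact sub_self (u.1 * u.2)
  leibniz_lie u v w := by
    apply Prod.ext <;> simp
    ring

instance : LieAlgebra ℝ AffR where
  lie_smul c u w := by
    apply Prod.ext <;> simp
    ring

end AffR

/-- The abelian Lie algebra `ℝ`: its bracket is the commutator of the commutative ring `ℝ`. -/
instance : LieRing ℝ := LieRing.ofAssociativeRing

instance : LieAlgebra ℝ ℝ := LieAlgebra.ofAssociativeAlgebra

/-- The Lie algebra `aff(ℝ) ⊕ ℝ`: the direct sum of `aff(ℝ)` and the abelian Lie algebra `ℝ`. -/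
abbrev AffRSumR : Type := AffR × ℝ

/-! ### Lorentzian forms, causal character of a line, idempotents -/

section Forms

variable {V : Type*} [AddCommGroup V] [Module ℝ V]

/-- A Lorentzian scalar product: symmetric, nondegenerate, of signature `(-, +, …, +)`. -/
structure IsLorentzian (q : LinearMap.BilinForm ℝ V) : Prop where
  isSymm : q.IsSymm
  nondegenerate : LinearMap.BilinForm.Nondegenerate q
  sigNeg_eq_one : sigNeg q.toQuadraticMap = 1

/-- The line `W` is spacelike. -/
def IsSpacelike (q : LinearMap.BilinForm ℝ V) (W : Submodule ℝ V) : Prop :=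
  ∀ w ∈ W, w ≠ 0 → 0 < q w w

/-- The line `W` is timelike. -/
def IsTimelike (q : LinearMap.BilinForm ℝ V) (W : Submodule ℝ V) : Prop :=
  ∀ w ∈ W, w ≠ 0 → q w w < 0

/-- The line `W` is lightlike. -/
def IsLightlike (q : LinearMap.BilinForm ℝ V) (W : Submodule ℝ V) : Prop :=
  ∀ w ∈ W, q w w = 0

/-- The subspaces `W` and `W'` are orthogonal. -/
def AreOrthogonal (q : LinearMap.BilinForm ℝ V) (W W' : Submodule ℝ V) : Prop :=
  ∀ w ∈ W, ∀ w' ∈ W', q w w' = 0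

end Forms

/-- The geodesic field `v ↦ ad†_v v`, where `ad†_v` is the `q`-transpose of `ad_v`. -/
def geodesicField {L : Type*} [LieRing L] [LieAlgebra ℝ L] [FiniteDimensional ℝ L]
    (q : LinearMap.BilinForm ℝ L) (hq : q.Nondegenerate) (v : L) : L :=
  q.leftAdjointOfNondegenerate hq (LieAlgebra.ad ℝ L v) v

/-- An idempotent of a vector field `F` on a vector space: a nonzero vector `v` with `F v = v`. -/
def IsIdempotentOf {V : Type*} [AddCommGroup V] (F : V → V) (v : V) : Prop :=
  v ≠ 0 ∧ F v = v

/-! ### Integral curves of a vector field on a vector space -/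

section Curves

variable {V : Type*} [NormedAddCommGroup V] [NormedSpace ℝ V]

/-- `v`, restricted to `J`, is an integral curve of `F`, and `J` is a nonempty open interval. -/
structure IsIntegralCurveOnInterval (F : V → V) (v : ℝ → V) (J : Set ℝ) : Prop where
  nonempty : J.Nonempty
  isOpen : IsOpen J
  ordConnected : J.OrdConnected
  isIntegralCurveOn : IsIntegralCurveOn v (fun _ => F) J

/-- `v`, restricted to the open interval `J`, is an integral curve of `F` that has no extension to
a larger open interval. -/
def IsMaximalIntegralCurve (F : V → V) (v : ℝ → V) (J : Set ℝ) : Prop :=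
  IsIntegralCurveOnInterval F v J ∧
    ∀ (v' : ℝ → V) (J' : Set ℝ), IsIntegralCurveOnInterval F v' J' → J ⊆ J' → Set.EqOn v v' J →
      J' = J

/-- The curve `v` on `J` is stationary, that is, constant. -/
def IsStationaryOn (v : ℝ → V) (J : Set ℝ) : Prop :=
  ∃ c : V, ∀ t ∈ J, v t = c

end Curves

/-! ### Left-invariant metrics on Lie groups and their geodesics -/

instance : ENat.LEInfty (minSmoothness ℝ 3) :=
  ⟨by rw [minSmoothness_of_isRCLikeNormedField]; exact ENat.LEInfty.out⟩

section Geodesics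

variable {E : Type*} [NormedAddCommGroup E] [NormedSpace ℝ E]
  {G : Type*} [TopologicalSpace G] [ChartedSpace E G] [Group G] [LieGroup 𝓘(ℝ, E) ∞ G]

/-- The left-invariant metric on `G` defined by the bilinear form `q` on the Lie algebra of `G`:
`g_p(u, w) = q(dL_{p⁻¹} u, dL_{p⁻¹} w)`. -/
def leftInvariantMetric (q : LinearMap.BilinForm ℝ (GroupLieAlgebra 𝓘(ℝ, E) G)) (p : G)
    (u w : TangentSpace 𝓘(ℝ, E) p) : ℝ :=
  q (mfderiv 𝓘(ℝ, E) 𝓘(ℝ, E) (fun x : G => p⁻¹ * x) p u)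
    (mfderiv 𝓘(ℝ, E) 𝓘(ℝ, E) (fun x : G => p⁻¹ * x) p w)

/-- `D` is the Levi-Civita connection of the metric `g`: it is torsion free, and
`u (g(σ, τ)) = g(∇_u σ, τ) + g(σ, ∇_u τ)` for tangent vectors `u` and vector fields `σ`, `τ`.
Mathlib writes `∇_u σ` at the point `p` as `D σ p u`. -/
structure IsLeviCivita
    (g : ∀ p : G, TangentSpace 𝓘(ℝ, E) p → TangentSpace 𝓘(ℝ, E) p → ℝ)
    (D : CovariantDerivative 𝓘(ℝ, E) E (TangentSpace 𝓘(ℝ, E) : G → Type _)) : Prop where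
  torsion_free : ∀ (σ τ : ∀ p : G, TangentSpace 𝓘(ℝ, E) p) (p : G),
    MDiffAt (T% σ) p → MDiffAt (T% τ) p →
      D τ p (σ p) - D σ p (τ p) = VectorField.mlieBracket 𝓘(ℝ, E) σ τ p
  metric : ∀ (σ τ : ∀ p : G, TangentSpace 𝓘(ℝ, E) p) (p : G) (u : TangentSpace 𝓘(ℝ, E) p),
    MDiffAt (T% σ) p → MDiffAt (T% τ) p →
      mvfderiv 𝓘(ℝ, E) (fun x => g x (σ x) (τ x)) p u = g p (D σ p u) (τ p) + g p (σ p) (D τ p u)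

/-- The curve `γ : ℝ → G` is a geodesic of the metric `g`: its velocity is differentiable and
parallel along `γ` for the Levi-Civita connection `∇` of `g`.

In the global frame of left-invariant vector fields `v^L`, the velocity reads
`γ'(t) = (v t)^L (γ t)` for a curve `v` in the Lie algebra, and the covariant derivative of `γ'`
along `γ` is `(v' t)^L (γ t) + ∇_{γ'(t)} ((v t)^L)`, by the Leibniz rule. -/
def IsGeodesic (g : ∀ p : G, TangentSpace 𝓘(ℝ, E) p → TangentSpace 𝓘(ℝ, E) p → ℝ)
    (γ : ℝ → G) : Prop :=
  ∃ D : CovariantDerivative 𝓘(ℝ, E) E (TangentSpace 𝓘(ℝ, E) : G → Type _), IsLeviCivita g D ∧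
    ∃ v v' : ℝ → GroupLieAlgebra 𝓘(ℝ, E) G, ∀ t : ℝ,
      HasMFDerivAt 𝓘(ℝ, ℝ) 𝓘(ℝ, E) γ t
        ((1 : ℝ →L[ℝ] ℝ).smulRight (mulInvariantVectorField (v t) (γ t))) ∧
      HasDerivAt v (v' t) t ∧
      mulInvariantVectorField (v' t) (γ t) +
        D (mulInvariantVectorField (v t)) (γ t) (mulInvariantVectorField (v t) (γ t)) = 0

/-- The metric `g` is geodesically complete: for every point `p` and every tangent vector `u` at
`p` there is a geodesic, defined on all of `ℝ`, that starts at `p` with velocity `u`. -/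
def IsGeodesicallyComplete
    (g : ∀ p : G, TangentSpace 𝓘(ℝ, E) p → TangentSpace 𝓘(ℝ, E) p → ℝ) : Prop :=
  ∀ (p : G) (u : TangentSpace 𝓘(ℝ, E) p), ∃ γ : ℝ → G, IsGeodesic g γ ∧ γ 0 = p ∧
    HasMFDerivAt 𝓘(ℝ, ℝ) 𝓘(ℝ, E) γ 0 ((1 : ℝ →L[ℝ] ℝ).smulRight u)

end Geodesics

end

set_option linter.unusedSectionVars false

/-! Written in the left-invariant frame, the velocity `v` of a geodesic satisfies `v' = F(v)` on the
Lie algebra. Conversely, every global solution develops to a global geodesic, since the linear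
equation `γ' = dL_γ v` on the group never blows up. So completeness of the metric is completeness of
the quadratic field `F` (`isGeodesicallyComplete_iff_of_lieEquiv`), and the rest is algebra in a
basis `A`, `B`, `Z` with `[A, B] = B` and `Z` central. Both `q(v, v)` and `q(v, Z)` are first
integrals.

An idempotent `x` gives the solution `(1 - t)⁻¹ x`, which blows up. Idempotents are exactly the
lightlike vectors of `Z^⊥` with `A`-coordinate `1`. If `Z` is spacelike, `Z^⊥` is a Lorentzian plane
and a quadratic equation produces such a vector (`exists_isIdempotentOf_geodesicField`).

If `Z` is timelike, reversing the sign of `q` along `Z` gives a positive definite first integral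
(`pos_of_timelike`), so every solution stays in a compact set.

If `Z` is lightlike, the lightlike vectors of `Z^⊥` are the multiples of `Z`, so no idempotent
exists. When `q(Z, B) ≠ 0`, an affine function `u` of `q(v, W)`, for a suitable `W` in `Z^⊥`,
satisfies `u' = u²` and `u(0) = 1` along a well chosen solution, so completeness fails. When `q(Z,
B) = 0`, the `A`-coordinate is constant, `q(v, B)` is exponential in time, and the equation
integrates explicitly (`orthogonalCurve`). -/

noncomputable section

/-! ### The transpose of `ad` and the Koszul product on a Lie algebra. -/

section LieAlgebra

variable {L : Type*} [LieRing L] [LieAlgebra ℝ L] [FiniteDimensional ℝ L]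
  (q : LinearMap.BilinForm ℝ L) (hq : q.Nondegenerate)

theorem LinearMap.BilinForm.Nondegenerate.eq_of_forall_left {V : Type*} [AddCommGroup V]
    [Module ℝ V] {q : LinearMap.BilinForm ℝ V} (hq : q.Nondegenerate) {x y : V}
    (h : ∀ w, q x w = q y w) : x = y := by
  rw [← sub_eq_zero]
  refine hq.1 _ fun w => ?_
  rw [map_sub, LinearMap.sub_apply, h w, sub_self]

/-- The bilinear map `(u, v) ↦ ad†_u v`, where `ad†_u` is the `q`-transpose of `ad_u`. -/
def adTranspose : L →ₗ[ℝ] L →ₗ[ℝ] L :=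
  LinearMap.mk₂ ℝ (fun u v => q.leftAdjointOfNondegenerate hq (LieAlgebra.ad ℝ L u) v)
    (fun u u' v => hq.eq_of_forall_left fun w => by
      have h := fun x : L =>
        LinearMap.BilinForm.isAdjointPairLeftAdjointOfNondegenerate q hq (LieAlgebra.ad ℝ L x)
      simp only [map_add, LinearMap.add_apply] at h ⊢
      have h₁ := h (u + u') v w
      rw [map_add] at h₁
      rw [h₁, h u, h u', LinearMap.add_apply, map_add])
    (fun c u v => hq.eq_of_forall_left fun w => by
      have h := fun x : L =>
        LinearMap.BilinForm.isAdjointPairLeftAdjointOfNondegenerate q hq (LieAlgebra.ad ℝ L x)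
      rw [h, map_smul, map_smul, LinearMap.smul_apply, LinearMap.smul_apply, map_smul, h])
    (fun u v v' => map_add _ _ _)
    (fun c u v => map_smul _ _ _)

theorem apply_adTranspose (u v w : L) : q (adTranspose q hq u v) w = q v ⁅u, w⁆ :=
  LinearMap.BilinForm.isAdjointPairLeftAdjointOfNondegenerate q hq (LieAlgebra.ad ℝ L u) v w

theorem geodesicField_eq_adTranspose (v : L) :
    geodesicField q hq v = adTranspose q hq v v := rfl

theorem apply_geodesicField (v w : L) : q (geodesicField q hq v) w = q v ⁅v, w⁆ :=
  apply_adTranspose q hq v v w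

/-- The Levi-Civita connection of a left-invariant metric, as a bilinear map on the
Lie algebra. -/
def koszul : L →ₗ[ℝ] L →ₗ[ℝ] L :=
  (2⁻¹ : ℝ) • ((LieModule.toEnd ℝ L L : L →ₗ[ℝ] L →ₗ[ℝ] L) - (adTranspose q hq).flip -
    adTranspose q hq)

theorem koszul_apply (u v : L) :
    koszul q hq u v = (2⁻¹ : ℝ) • (⁅u, v⁆ - adTranspose q hq v u - adTranspose q hq u v) := rfl

/-- The transpose terms are symmetric in `u`, `v` and cancel. This is torsion-freeness at the Lie
algebra level. -/
theorem koszul_sub_koszul (u v : L) : koszul q hq u v - koszul q hq v u = ⁅u, v⁆ := by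
  rw [koszul_apply, koszul_apply, ← lie_skew u v]
  module

/-- It turns the geodesic equation `v' + ∇_v v = 0` into `v' = F(v)`. -/
theorem koszul_self (v : L) : koszul q hq v v = -geodesicField q hq v := by
  rw [koszul_apply, lie_self, geodesicField_eq_adTranspose]
  module

/-- Metric compatibility for left-invariant fields, whose inner products are constant. -/
theorem apply_koszul_add (hs : q.IsSymm) (u v w : L) :
    q (koszul q hq u v) w + q v (koszul q hq u w) = 0 := by
  have h : ∀ x y z : L, q (koszul q hq x y) z = 2⁻¹ * (q ⁅x, y⁆ z - q x ⁅y, z⁆ - q y ⁅x, z⁆) := by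
    intro x y z
    simp only [koszul_apply, map_smul, map_sub, LinearMap.smul_apply, LinearMap.sub_apply,
      apply_adTranspose, smul_eq_mul]
  rw [hs.eq v, h, h, hs.eq v, hs.eq w ⁅u, v⁆, ← lie_skew w v, map_neg]
  ring

end LieAlgebra

/-- The geodesic field is natural with respect to isometric isomorphisms of Lie algebras. -/
theorem geodesicField_comp {L L' : Type*} [LieRing L] [LieAlgebra ℝ L] [FiniteDimensional ℝ L]
    [LieRing L'] [LieAlgebra ℝ L'] [FiniteDimensional ℝ L'] (e : L' ≃ₗ⁅ℝ⁆ L)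
    (q : LinearMap.BilinForm ℝ L) (hq : q.Nondegenerate) (q' : LinearMap.BilinForm ℝ L')
    (hq' : q'.Nondegenerate) (h : ∀ x y, q' x y = q (e x) (e y)) (v : L') :
    e (geodesicField q' hq' v) = geodesicField q hq (e v) := by
  refine hq.eq_of_forall_left fun w => ?_
  obtain ⟨w, rfl⟩ : ∃ w', e w' = w := e.surjective w
  rw [apply_geodesicField, ← h, apply_geodesicField, h, LieEquiv.map_lie]

/-! ### Lorentzian forms: consequences of index one. -/

section Lorentzian

variable {V : Type*} [AddCommGroup V] [Module ℝ V] [FiniteDimensional ℝ V]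
  {q : LinearMap.BilinForm ℝ V}

theorem IsLorentzian.exists_neg (hq : IsLorentzian q) : ∃ x, q x x < 0 := by
  obtain ⟨W, hW, hneg⟩ := exists_finrank_eq_sigNeg_and_negDef q.toQuadraticMap
  rw [hq.sigNeg_eq_one] at hW
  have : Nontrivial W := Module.nontrivial_of_finrank_pos (R := ℝ) (by omega)
  obtain ⟨x, hx⟩ := exists_ne (0 : W)
  refine ⟨x, ?_⟩
  have := hneg x hx
  simpa using this

/-- The orthogonal complement of a timelike vector contains no timelike vector. -/
theorem IsLorentzian.nonneg_of_apply_eq_zero (hq : IsLorentzian q) {x y : V} (hx : q x x < 0)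
    (hxy : q x y = 0) : 0 ≤ q y y := by
  by_contra! hy
  have key : ∀ s t : ℝ, q (s • x + t • y) (s • x + t • y) = s ^ 2 * q x x + t ^ 2 * q y y := by
    intro s t
    simp only [map_add, map_smul, LinearMap.add_apply, LinearMap.smul_apply, smul_eq_mul,
      hq.isSymm.eq y x, hxy]
    ring
  have hneg : ∀ s t : ℝ, ¬(s = 0 ∧ t = 0) → q (s • x + t • y) (s • x + t • y) < 0 := by
    intro s t hst
    rw [key]
    by_cases hs : s = 0
    · have ht : t ≠ 0 := fun h => hst ⟨hs, h⟩
      have := mul_neg_of_pos_of_neg (pow_pos (abs_pos.mpr ht) 2) hy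
      rw [sq_abs] at this
      rw [hs]
      linarith
    · have := mul_neg_of_pos_of_neg (pow_pos (abs_pos.mpr hs) 2) hx
      rw [sq_abs] at this
      nlinarith [sq_nonneg t]
  have hli : LinearIndependent ℝ ![x, y] := by
    rw [LinearIndependent.pair_iff]
    intro s t h
    by_contra hst
    have := hneg s t hst
    rw [h] at this
    simp at this
  have hfin := finrank_span_eq_card hli
  -- Two orthogonal timelike vectors would span a negative definite plane, against index one.
  have hle := le_sigNeg_of_negDef q.toQuadraticMap (V := Submodule.span ℝ (Set.range ![x, y])) (by
    rintro ⟨w, hw⟩ hw0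
    have hw' := hw
    rw [Matrix.range_cons, Matrix.range_cons, Matrix.range_empty, Set.union_empty,
      Set.singleton_union, Submodule.mem_span_pair] at hw'
    obtain ⟨s, t, rfl⟩ := hw'
    have := hneg s t (by
      rintro ⟨rfl, rfl⟩
      exact hw0 (Subtype.ext (by simp)))
    simp at this ⊢
    linarith)
  rw [hfin, hq.sigNeg_eq_one] at hle
  simp at hle

end Lorentzian

/-! ### Algebra of the geodesic field on `aff(ℝ) ⊕ ℝ`. -/

namespace AffRSumR

/-- The infinitesimal dilation in `aff(ℝ) ⊕ ℝ`. -/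
def A : AffRSumR := (((1, 0) : ℝ × ℝ), 0)

/-- The infinitesimal translation in `aff(ℝ) ⊕ ℝ`, which spans the derived subalgebra. -/
def B : AffRSumR := (((0, 1) : ℝ × ℝ), 0)

/-- The vector that spans the center of `aff(ℝ) ⊕ ℝ`. -/
def Z : AffRSumR := (((0, 0) : ℝ × ℝ), 1)

/-- The coordinate along `A`. -/
def fstₗ : AffRSumR →ₗ[ℝ] ℝ where
  toFun v := v.1.1
  map_add' _ _ := rfl
  map_smul' _ _ := rfl

/-- The coordinate along `B`. -/
def sndₗ : AffRSumR →ₗ[ℝ] ℝ where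
  toFun v := v.1.2
  map_add' _ _ := rfl
  map_smul' _ _ := rfl

/-- The coordinate along `Z`. -/
def thdₗ : AffRSumR →ₗ[ℝ] ℝ where
  toFun v := v.2
  map_add' _ _ := rfl
  map_smul' _ _ := rfl

theorem eq_sum (v : AffRSumR) : v = fstₗ v • A + sndₗ v • B + thdₗ v • Z := by
  refine Prod.ext (Prod.ext ?_ ?_) ?_
  · change v.1.1 = v.1.1 * 1 + v.1.2 * 0 + v.2 * 0
    ring
  · change v.1.2 = v.1.1 * 0 + v.1.2 * 1 + v.2 * 0
    ring
  · change v.2 = v.1.1 * 0 + v.1.2 * 0 + v.2 * 1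
    ring

@[simp] theorem fstₗ_A : fstₗ A = 1 := rfl
@[simp] theorem fstₗ_B : fstₗ B = 0 := rfl
@[simp] theorem fstₗ_Z : fstₗ Z = 0 := rfl
@[simp] theorem sndₗ_A : sndₗ A = 0 := rfl
@[simp] theorem sndₗ_B : sndₗ B = 1 := rfl
@[simp] theorem sndₗ_Z : sndₗ Z = 0 := rfl
@[simp] theorem thdₗ_A : thdₗ A = 0 := rfl
@[simp] theorem thdₗ_B : thdₗ B = 0 := rfl
@[simp] theorem thdₗ_Z : thdₗ Z = 1 := rfl

theorem lie_eq (u v : AffRSumR) : ⁅u, v⁆ = (fstₗ u * sndₗ v - fstₗ v * sndₗ u) • B := by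
  refine Prod.ext (Prod.ext ?_ ?_) ?_
  · change (0 : ℝ) = (fstₗ u * sndₗ v - fstₗ v * sndₗ u) * 0
    ring
  · change fstₗ u * sndₗ v - fstₗ v * sndₗ u = (fstₗ u * sndₗ v - fstₗ v * sndₗ u) * 1
    ring
  · change u.2 * v.2 - v.2 * u.2 = (fstₗ u * sndₗ v - fstₗ v * sndₗ u) * 0
    ring

theorem Z_ne_zero : Z ≠ 0 := fun h => by
  have := congrArg thdₗ h
  simp at this

theorem Z_mem_center : Z ∈ LieAlgebra.center ℝ AffRSumR := by
  refine (LieModule.mem_maxTrivSubmodule ℝ AffRSumR AffRSumR Z).2 fun x => ?_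
  rw [lie_eq]
  simp

theorem eq_smul_Z_of_mem_center {w : AffRSumR} (hw : w ∈ LieAlgebra.center ℝ AffRSumR) :
    ∃ c : ℝ, w = c • Z := by
  have h := (LieModule.mem_maxTrivSubmodule ℝ AffRSumR AffRSumR w).1 hw
  have hA := congrArg sndₗ (h A)
  have hB := congrArg sndₗ (h B)
  rw [lie_eq] at hA hB
  simp only [map_smul, fstₗ_A, fstₗ_B, sndₗ_A, sndₗ_B, map_zero, smul_eq_mul] at hA hB
  refine ⟨thdₗ w, ?_⟩
  have h1 : fstₗ w = 0 := by linarith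
  have h2 : sndₗ w = 0 := by linarith
  nth_rw 1 [eq_sum w]
  rw [h1, h2]
  module

theorem derivedSeries_one_eq :
    (LieAlgebra.derivedSeries ℝ AffRSumR 1).toSubmodule = Submodule.span ℝ {B} := by
  rw [LieAlgebra.derivedSeries_def, LieAlgebra.derivedSeriesOfIdeal_succ,
    LieAlgebra.derivedSeriesOfIdeal_zero, LieSubmodule.lieIdeal_oper_eq_linear_span]
  refine le_antisymm (Submodule.span_le.2 ?_) (Submodule.span_le.2 ?_)
  · rintro _ ⟨u, v, rfl⟩
    rw [lie_eq]
    exact Submodule.smul_mem _ _ (Submodule.mem_span_singleton_self B)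
  · rintro _ rfl
    refine Submodule.subset_span ⟨⟨A, trivial⟩, ⟨B, trivial⟩, ?_⟩
    rw [lie_eq]
    simp

variable {q : LinearMap.BilinForm ℝ AffRSumR}

theorem apply_eq (q : LinearMap.BilinForm ℝ AffRSumR) (v w : AffRSumR) :
    q v w = fstₗ w * q v A + sndₗ w * q v B + thdₗ w * q v Z := by
  nth_rw 1 [eq_sum w]
  simp only [map_add, map_smul, smul_eq_mul]

theorem apply_eq_left (q : LinearMap.BilinForm ℝ AffRSumR) (v w : AffRSumR) :
    q v w = fstₗ v * q A w + sndₗ v * q B w + thdₗ v * q Z w := by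
  nth_rw 1 [eq_sum v]
  simp only [map_add, map_smul, LinearMap.add_apply, LinearMap.smul_apply, smul_eq_mul]

theorem ext_of_apply (hq : q.Nondegenerate) {v w : AffRSumR} (hA : q v A = q w A)
    (hB : q v B = q w B) (hZ : q v Z = q w Z) : v = w :=
  hq.eq_of_forall_left fun x => by rw [apply_eq q v, apply_eq q w, hA, hB, hZ]

/-- All brackets are multiples of `B`, so the pairings of `F v` with the basis involve only `q v B`
and the first two coordinates of `v`. These pairings determine `F v` and stand in for an explicit
formula. -/
theorem apply_geodesicField_A (hq : q.Nondegenerate) (v : AffRSumR) :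
    q (geodesicField q hq v) A = -(sndₗ v * q v B) := by
  rw [apply_geodesicField, lie_eq]
  simp

theorem apply_geodesicField_B (hq : q.Nondegenerate) (v : AffRSumR) :
    q (geodesicField q hq v) B = fstₗ v * q v B := by
  rw [apply_geodesicField, lie_eq]
  simp

theorem apply_geodesicField_Z (hq : q.Nondegenerate) (v : AffRSumR) :
    q (geodesicField q hq v) Z = 0 := by
  rw [apply_geodesicField, lie_eq]
  simp

theorem apply_geodesicField_self (hq : q.Nondegenerate) (v : AffRSumR) :
    q (geodesicField q hq v) v = 0 := by
  rw [apply_geodesicField, lie_self, map_zero]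

/-- Idempotents of the geodesic field are lightlike vectors orthogonal to the center, with
coordinate `1` along `A`. -/
theorem isIdempotentOf_geodesicField_iff (hq : q.Nondegenerate) (v : AffRSumR) :
    IsIdempotentOf (geodesicField q hq) v ↔ fstₗ v = 1 ∧ q v Z = 0 ∧ q v v = 0 := by
  constructor
  · rintro ⟨hv, h⟩
    have hA := apply_geodesicField_A hq v
    have hB := apply_geodesicField_B hq v
    have hZ := apply_geodesicField_Z hq v
    have hv' := apply_geodesicField_self hq v
    rw [h] at hA hB hZ hv'
    refine ⟨?_, hZ, hv'⟩
    by_contra h1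
    -- Pairing `F v = v` with `B` gives `q v B = fstₗ v * q v B`. Once `q v B` vanishes, so do the
    -- other two pairings, and `v = 0`.
    have hB0 : q v B = 0 := by
      have : (1 - fstₗ v) * q v B = 0 := by linear_combination hB
      exact (mul_eq_zero.1 this).resolve_left fun h => h1 (by linarith)
    refine hv (ext_of_apply hq ?_ ?_ ?_)
    · rw [hA, hB0]; simp
    · rw [hB0]; simp
    · rw [hZ]; simp
  · rintro ⟨h1, hZ, h⟩
    refine ⟨?_, ext_of_apply hq ?_ ?_ ?_⟩
    · rintro rfl
      simp at h1
    · rw [apply_geodesicField_A]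
      rw [apply_eq q v v, h1, hZ] at h
      linarith
    · rw [apply_geodesicField_B, h1, one_mul]
    · rw [apply_geodesicField_Z, hZ]

theorem contDiff_geodesicField (hq : q.Nondegenerate) {n : ℕ∞ω} :
    ContDiff ℝ n (geodesicField q hq) := by
  let T : AffRSumR →ₗ[ℝ] AffRSumR →L[ℝ] AffRSumR :=
    (LinearMap.toContinuousLinearMap : (AffRSumR →ₗ[ℝ] AffRSumR) ≃ₗ[ℝ] _).toLinearMap ∘ₗ
      adTranspose q hq
  have : geodesicField q hq = fun v => LinearMap.toContinuousLinearMap T v v := rfl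
  rw [this]
  exact (ContinuousLinearMap.contDiff _).clm_apply contDiff_id

/-- The geometry of the plane orthogonal to the center, when the center is not lightlike. -/
theorem mul_sub_ne_zero (hs : q.IsSymm) (hq : q.Nondegenerate) (hZ : q Z Z ≠ 0) {A' B' : AffRSumR}
    (hA' : A' = A - (q A Z / q Z Z) • Z) (hB' : B' = B - (q B Z / q Z Z) • Z) :
    q A' A' * q B' B' - q A' B' ^ 2 ≠ 0 := by
  intro h
  have hAZ : q A' Z = 0 := by
    rw [hA']
    simp [hZ]
  have hBZ : q B' Z = 0 := by
    rw [hB']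
    simp [hZ]
  have hqA : ∀ x, q x Z = 0 → q x A = q x A' := fun x hx => by rw [hA']; simp [hx]
  have hqB : ∀ x, q x Z = 0 → q x B = q x B' := fun x hx => by rw [hB']; simp [hx]
  have hB0 : fstₗ B' = 0 ∧ sndₗ B' = 1 := by rw [hB']; simp
  have hA0 : fstₗ A' = 1 ∧ sndₗ A' = 0 := by rw [hA']; simp
  -- The Gram matrix has trivial kernel: a kernel vector gives a combination of `A'` and `B'`
  -- orthogonal to everything.
  have h0 : ∀ x y : ℝ, x * q A' A' + y * q A' B' = 0 → x * q A' B' + y * q B' B' = 0 →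
      x = 0 ∧ y = 0 := by
    intro x y h1 h2
    have hxy : x • A' + y • B' = 0 := by
      have hz : q (x • A' + y • B') Z = 0 := by simp [hAZ, hBZ]
      refine ext_of_apply hq ?_ ?_ ?_
      · rw [hqA _ hz]
        simpa [hs.eq B' A'] using h1
      · rw [hqB _ hz]
        simpa using h2
      · rw [hz]; simp
    have hx := congrArg fstₗ hxy
    have hy := congrArg sndₗ hxy
    simp only [map_add, map_smul, hA0, hB0, smul_eq_mul, map_zero] at hx hy
    constructor <;> linarith
  -- If the determinant vanishes, this row of the adjugate is in the kernel, so `q A' A' = q A' B' =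
  -- 0`. Then `(1, 0)` is in the kernel as well.
  have hab := h0 (q A' B') (-q A' A') (by ring) (by linear_combination -h)
  have hab' := h0 1 0 (by linear_combination -hab.2) (by linear_combination hab.1)
  exact one_ne_zero hab'.1

/-- If the center is spacelike, then the geodesic field has an idempotent. -/
theorem exists_isIdempotentOf_geodesicField (hq : IsLorentzian q) (hZ : 0 < q Z Z) :
    ∃ v, IsIdempotentOf (geodesicField q hq.nondegenerate) v := by
  obtain ⟨A', hA'⟩ : ∃ A', A' = A - (q A Z / q Z Z) • Z := ⟨_, rfl⟩
  obtain ⟨B', hB'⟩ : ∃ B', B' = B - (q B Z / q Z Z) • Z := ⟨_, rfl⟩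
  have hdisc := mul_sub_ne_zero hq.isSymm hq.nondegenerate hZ.ne' hA' hB'
  have hAZ : q A' Z = 0 := by rw [hA']; simp [hZ.ne']
  have hBZ : q B' Z = 0 := by rw [hB']; simp [hZ.ne']
  have hB0 : fstₗ B' = 0 ∧ sndₗ B' = 1 := by rw [hB']; simp
  have hA0 : fstₗ A' = 1 ∧ sndₗ A' = 0 := by rw [hA']; simp
  have hBA : q B' A' = q A' B' := hq.isSymm.eq _ _
  have hquad : ∀ x y : ℝ, q (x • A' + y • B') (x • A' + y • B') =
      x ^ 2 * q A' A' + 2 * x * y * q A' B' + y ^ 2 * q B' B' := by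
    intro x y
    simp only [map_add, map_smul, LinearMap.add_apply, LinearMap.smul_apply, smul_eq_mul, hBA]
    ring
  -- Removing the `Z`-component of a timelike vector only lowers its square, because `Z` is
  -- spacelike.
  have hneg : ∃ x y : ℝ, x ^ 2 * q A' A' + 2 * x * y * q A' B' + y ^ 2 * q B' B' < 0 := by
    obtain ⟨w, hw⟩ := hq.exists_neg
    refine ⟨fstₗ w, sndₗ w, ?_⟩
    rw [← hquad]
    have hw' : w = fstₗ w • A' + sndₗ w • B' + (q w Z / q Z Z) • Z := by
      have h1 : w = fstₗ w • A' + sndₗ w • B' +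
          (thdₗ w + fstₗ w * (q A Z / q Z Z) + sndₗ w * (q B Z / q Z Z)) • Z := by
        nth_rw 1 [eq_sum w]
        rw [hA', hB']
        module
      have h2 : q w Z / q Z Z = thdₗ w + fstₗ w * (q A Z / q Z Z) + sndₗ w * (q B Z / q Z Z) := by
        rw [apply_eq_left q w Z]
        field_simp
        ring
      rw [h2]
      exact h1
    generalize hu : fstₗ w • A' + sndₗ w • B' = u at hw' ⊢
    have huZ : q u Z = 0 := by rw [← hu]; simp [hAZ, hBZ]
    have hZu : q Z u = 0 := by rw [hq.isSymm.eq, huZ]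
    generalize q w Z / q Z Z = c at hw'
    rw [hw'] at hw
    simp only [map_add, map_smul, LinearMap.add_apply, LinearMap.smul_apply, smul_eq_mul, huZ,
      hZu] at hw
    nlinarith [mul_nonneg (sq_nonneg c) hZ.le]
  -- The vector used is orthogonal to `A'`; its square is `q A' A'` times the Gram determinant. This
  -- excludes a negative definite plane.
  have hnegA : q A' A' < 0 → 0 ≤ q B' B' * q A' A' ^ 2 - q A' B' ^ 2 * q A' A' := by
    intro h
    have h1 : q A' (q A' A' • B' - q A' B' • A') = 0 := by
      simp only [map_sub, map_smul, smul_eq_mul]; ring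
    have h2 := hq.nonneg_of_apply_eq_zero h h1
    simp only [map_sub, map_smul, LinearMap.sub_apply, LinearMap.smul_apply, smul_eq_mul,
      hBA] at h2
    linarith
  obtain ⟨y, hy⟩ : ∃ y : ℝ, q A' A' + 2 * y * q A' B' + y ^ 2 * q B' B' = 0 := by
    generalize q A' A' = P at *
    generalize q A' B' = S at *
    generalize q B' B' = T at *
    -- Otherwise the plane is definite: negative definiteness contradicts `hnegA`, positive
    -- definiteness contradicts `hneg`.
    have hpos : 0 < S ^ 2 - P * T := by
      obtain ⟨x, y, hxy⟩ := hneg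
      by_contra! hle
      have hlt : 0 < P * T - S ^ 2 := lt_of_le_of_ne (by linarith) (Ne.symm hdisc)
      rcases lt_trichotomy P 0 with hP | hP | hP
      · nlinarith [hnegA hP]
      · rw [hP] at hlt
        nlinarith [sq_nonneg S]
      · have : 0 ≤ P * (x ^ 2 * P + 2 * x * y * S + y ^ 2 * T) := by
          nlinarith [sq_nonneg (P * x + S * y), mul_nonneg (sq_nonneg y) hlt.le]
        nlinarith
    by_cases hT : T = 0
    · subst hT
      have hS : S ≠ 0 := by
        rintro rfl
        simp at hpos
      refine ⟨-P / (2 * S), ?_⟩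
      field_simp
      ring
    · refine ⟨(-S + √(S ^ 2 - P * T)) / T, ?_⟩
      have hsq := Real.sq_sqrt hpos.le
      field_simp
      linear_combination hsq
  refine ⟨(1 : ℝ) • A' + y • B', ?_⟩
  rw [isIdempotentOf_geodesicField_iff]
  refine ⟨by simp [hA0, hB0], by simp [hAZ, hBZ], ?_⟩
  rw [hquad]
  linarith

/-- If the center is timelike, then the first integral `q(v, v) - 2 q(v, Z)² / q(Z, Z)` of the
geodesic field is positive definite. -/
theorem pos_of_timelike (hq : IsLorentzian q) (hZ : q Z Z < 0) {v : AffRSumR} (hv : v ≠ 0) :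
    0 < q v v - 2 * q v Z ^ 2 / q Z Z := by
  obtain ⟨A', hA'⟩ : ∃ A', A' = A - (q A Z / q Z Z) • Z := ⟨_, rfl⟩
  obtain ⟨B', hB'⟩ : ∃ B', B' = B - (q B Z / q Z Z) • Z := ⟨_, rfl⟩
  have hdisc := mul_sub_ne_zero hq.isSymm hq.nondegenerate hZ.ne hA' hB'
  have hAZ : q A' Z = 0 := by rw [hA']; simp [hZ.ne]
  have hBZ : q B' Z = 0 := by rw [hB']; simp [hZ.ne]
  have hBA : q B' A' = q A' B' := hq.isSymm.eq _ _
  have hquad : ∀ x y : ℝ, q (x • A' + y • B') (x • A' + y • B') =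
      x ^ 2 * q A' A' + 2 * x * y * q A' B' + y ^ 2 * q B' B' := by
    intro x y
    simp only [map_add, map_smul, LinearMap.add_apply, LinearMap.smul_apply, smul_eq_mul, hBA]
    ring
  have hnonneg : ∀ x y : ℝ, 0 ≤ x ^ 2 * q A' A' + 2 * x * y * q A' B' + y ^ 2 * q B' B' := by
    intro x y
    rw [← hquad]
    refine hq.nonneg_of_apply_eq_zero hZ ?_
    rw [hq.isSymm.eq]
    simp [hAZ, hBZ]
  have hv' : v = fstₗ v • A' + sndₗ v • B' + (q v Z / q Z Z) • Z := by
    have h2 : q v Z / q Z Z = thdₗ v + fstₗ v * (q A Z / q Z Z) + sndₗ v * (q B Z / q Z Z) := by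
      rw [apply_eq_left q v Z]
      field_simp [hZ.ne]
      ring
    nth_rw 1 [eq_sum v]
    rw [h2, hA', hB']
    module
  have hvv : q v v = fstₗ v ^ 2 * q A' A' + 2 * fstₗ v * sndₗ v * q A' B' +
      sndₗ v ^ 2 * q B' B' + q v Z ^ 2 / q Z Z := by
    generalize hc : q v Z / q Z Z = c at hv'
    have hc' : q v Z ^ 2 / q Z Z = c ^ 2 * q Z Z := by
      rw [← hc]
      field_simp [hZ.ne]
    rw [hc', ← hquad]
    generalize hu : fstₗ v • A' + sndₗ v • B' = u at hv' ⊢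
    have huZ : q u Z = 0 := by rw [← hu]; simp [hAZ, hBZ]
    have hZu : q Z u = 0 := by rw [hq.isSymm.eq, huZ]
    rw [hv']
    simp only [map_add, map_smul, LinearMap.add_apply, LinearMap.smul_apply, smul_eq_mul, huZ,
      hZu]
    ring
  have hzz : 0 ≤ q v Z ^ 2 / -q Z Z := div_nonneg (sq_nonneg _) (by linarith)
  rw [div_neg] at hzz
  have hform : q v v - 2 * q v Z ^ 2 / q Z Z = fstₗ v ^ 2 * q A' A' +
      2 * fstₗ v * sndₗ v * q A' B' + sndₗ v ^ 2 * q B' B' + -(q v Z ^ 2 / q Z Z) := by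
    rw [hvv]; ring
  rw [hform]
  refine lt_of_le_of_ne (add_nonneg (hnonneg _ _) hzz) fun h0 => hv ?_
  have h1 : fstₗ v ^ 2 * q A' A' + 2 * fstₗ v * sndₗ v * q A' B' + sndₗ v ^ 2 * q B' B' = 0 := by
    linarith [hnonneg (fstₗ v) (sndₗ v)]
  have h2 : q v Z / q Z Z = 0 := by
    have : q v Z ^ 2 / q Z Z = 0 := by linarith [hnonneg (fstₗ v) (sndₗ v)]
    rcases div_eq_zero_iff.1 this with h | h
    · rw [pow_eq_zero_iff two_ne_zero] at h
      rw [h, zero_div]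
    · exact absurd h hZ.ne
  rw [h2] at hv'
  have hab : fstₗ v = 0 ∧ sndₗ v = 0 := by
    generalize fstₗ v = x at *
    generalize sndₗ v = y at *
    generalize q A' A' = P at *
    generalize q A' B' = S at *
    generalize q B' B' = T at *
    have hP : 0 ≤ P := by simpa using hnonneg 1 0
    have hT : 0 ≤ T := by simpa using hnonneg 0 1
    -- The first two evaluations are `P` and `T` times the determinant, so a negative determinant
    -- forces `P = T = 0`; the third then reads `-2 * S ^ 2 ≥ 0`.
    have hdet : 0 ≤ P * T - S ^ 2 := by
      by_contra! hlt
      have e1 := hnonneg S (-P)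
      have e2 := hnonneg T (-S)
      have e3 := hnonneg 1 (-S)
      have e4 : P = 0 := by
        by_contra hP0
        have := lt_of_le_of_ne hP (Ne.symm hP0)
        nlinarith
      subst e4
      have e5 : T = 0 := by
        by_contra hT0
        have := lt_of_le_of_ne hT (Ne.symm hT0)
        nlinarith
      subst e5
      nlinarith
    have hdet' : 0 < P * T - S ^ 2 := lt_of_le_of_ne hdet (Ne.symm hdisc)
    have hP' : 0 < P := by
      refine lt_of_le_of_ne hP fun h => ?_
      subst h
      nlinarith [sq_nonneg S]
    have hy : y = 0 := by
      have : (P * x + S * y) ^ 2 + y ^ 2 * (P * T - S ^ 2) = 0 := by linear_combination P * h1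
      have h3 : y ^ 2 * (P * T - S ^ 2) = 0 := by
        linarith [sq_nonneg (P * x + S * y), mul_nonneg (sq_nonneg y) hdet]
      rcases mul_eq_zero.1 h3 with h | h
      · simpa using h
      · exact absurd h hdisc
    subst hy
    refine ⟨?_, rfl⟩
    have h3 : x ^ 2 * P = 0 := by linear_combination h1
    rcases mul_eq_zero.1 h3 with h | h
    · simpa using h
    · exact absurd h hP'.ne'
  rw [hv', hab.1, hab.2]
  simp

/-- If the center is lightlike and not orthogonal to the derived subalgebra, then the geodesic
field has no idempotent. -/
theorem not_exists_isIdempotentOf_geodesicField (hs : q.IsSymm) (hq : q.Nondegenerate)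
    (hZ : q Z Z = 0) (hZB : q Z B ≠ 0) : ¬ ∃ v, IsIdempotentOf (geodesicField q hq) v := by
  rintro ⟨v, hv⟩
  rw [isIdempotentOf_geodesicField_iff] at hv
  obtain ⟨h1, hvZ, hvv⟩ := hv
  have hvB : q v B * sndₗ v + q v A = 0 := by
    rw [apply_eq q v v, h1, hvZ] at hvv
    linarith
  have hZv : q Z A + sndₗ v * q Z B = 0 := by
    rw [hs.eq, apply_eq, h1, hZ] at hvZ
    linarith
  -- A lightlike vector of the degenerate plane `Z^⊥` is a multiple of `Z`; pairing with `B` gives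
  -- the factor. Such a vector has `A`-coordinate `0`, not `1`.
  have key : v = (q v B / q Z B) • Z := by
    refine ext_of_apply hq ?_ ?_ ?_
    · simp only [map_smul, LinearMap.smul_apply, smul_eq_mul]
      field_simp
      linear_combination q Z B * hvB - q v B * hZv
    · simp [hZB]
    · simp [hvZ, hZ]
  rw [key] at h1
  simp at h1

/-- If the center is lightlike and orthogonal to the derived subalgebra, then the two other
relevant coefficients of the form do not vanish. -/
theorem ne_zero_of_orthogonal (hs : q.IsSymm) (hq : q.Nondegenerate) (hZ : q Z Z = 0)
    (hZB : q Z B = 0) : q Z A ≠ 0 ∧ q B B ≠ 0 := by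
  have h1 : q Z A ≠ 0 := by
    intro h
    refine Z_ne_zero (ext_of_apply hq ?_ ?_ ?_) <;> simp [h, hZ, hZB]
  refine ⟨h1, fun h => ?_⟩
  have h2 : B = (q B A / q Z A) • Z := by
    refine ext_of_apply hq ?_ ?_ ?_
    · simp [h1]
    · simp [h, hZB]
    · rw [hs.eq]; simp [hZ, hZB]
  have := congrArg sndₗ h2
  simp at this

/-- The geodesic field when the center is lightlike and orthogonal to the derived subalgebra. -/
theorem geodesicField_of_orthogonal (hs : q.IsSymm) (hq : q.Nondegenerate) (hZ : q Z Z = 0)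
    (hZB : q Z B = 0) (v : AffRSumR) :
    geodesicField q hq v =
      (fstₗ v * q v B / q B B) • B - (q v B ^ 2 / (q Z A * q B B)) • Z := by
  obtain ⟨h1, h2⟩ := ne_zero_of_orthogonal hs hq hZ hZB
  have hBZ : q B Z = 0 := by rw [hs.eq, hZB]
  refine ext_of_apply hq ?_ ?_ ?_
  · rw [apply_geodesicField_A]
    simp only [map_sub, map_smul, LinearMap.sub_apply, LinearMap.smul_apply, smul_eq_mul]
    field_simp
    have : q v B = fstₗ v * q A B + sndₗ v * q B B := by
      rw [apply_eq_left q v B, hZB]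
      ring
    rw [hs.eq B A]
    linear_combination q v B * this
  · rw [apply_geodesicField_B]
    simp [hZB, h2]
  · rw [apply_geodesicField_Z]
    simp [hZ, hBZ]

end AffRSumR

/-! ### Integral curves on vector spaces: uniqueness, global existence, blow-up. -/

section Curves

variable {V : Type*} [NormedAddCommGroup V] [NormedSpace ℝ V] {F : V → V}

theorem isMIntegralCurveOn_iff_isIntegralCurveOn {v : ℝ → V} {J : Set ℝ} :
    IsMIntegralCurveOn (I := 𝓘(ℝ, V)) v (F : ∀ x : V, TangentSpace 𝓘(ℝ, V) x) J ↔
      IsIntegralCurveOn v (fun _ => F) J := by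
  refine forall₂_congr fun t _ => ?_
  rw [hasDerivWithinAt_iff_hasFDerivWithinAt]
  exact hasMFDerivWithinAt_iff_hasFDerivWithinAt

theorem ContDiff.contMDiff_vectorField (hF : ContDiff ℝ 1 F) :
    ContMDiff 𝓘(ℝ, V) 𝓘(ℝ, V).tangent 1
      (fun x => (⟨x, F x⟩ : TangentBundle 𝓘(ℝ, V) V)) :=
  contMDiff_vectorSpace_iff_contDiff.2 hF

/-- It reduces uniqueness on an arbitrary open interval, possibly unbounded, to uniqueness on
bounded ones. -/
theorem Set.OrdConnected.exists_Ioo_subset {J : Set ℝ} (hJ : J.OrdConnected) (hJo : IsOpen J)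
    {s t : ℝ} (hs : s ∈ J) (ht : t ∈ J) :
    ∃ a b, s ∈ Set.Ioo a b ∧ t ∈ Set.Ioo a b ∧ Set.Ioo a b ⊆ J := by
  obtain ⟨ε, hε, hsε⟩ := Metric.isOpen_iff.1 hJo s hs
  obtain ⟨δ, hδ, htδ⟩ := Metric.isOpen_iff.1 hJo t ht
  rw [Real.ball_eq_Ioo] at hsε htδ
  refine ⟨min (s - ε) (t - δ), max (s + ε) (t + δ), ?_, ?_, fun x hx => ?_⟩
  · exact ⟨(min_le_left _ _).trans_lt (by linarith), lt_max_of_lt_left (by linarith)⟩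
  · exact ⟨(min_le_right _ _).trans_lt (by linarith), lt_max_of_lt_right (by linarith)⟩
  · have key : ∀ y ∈ J, ∀ z ∈ J, y ≤ x → x ≤ z → x ∈ J := fun y hy z hz h1 h2 =>
      hJ.out hy hz ⟨h1, h2⟩
    obtain ⟨hx1, hx2⟩ := hx
    rw [min_lt_iff] at hx1
    rw [lt_max_iff] at hx2
    have hlow : x ∈ J ∨ ∃ y ∈ J, y ≤ x := by
      rcases hx1 with h | h
      · by_cases hxs : s ≤ x
        · exact Or.inr ⟨s, hs, hxs⟩
        · exact Or.inl (hsε ⟨h, by linarith⟩)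
      · by_cases hxt : t ≤ x
        · exact Or.inr ⟨t, ht, hxt⟩
        · exact Or.inl (htδ ⟨h, by linarith⟩)
    have hup : x ∈ J ∨ ∃ z ∈ J, x ≤ z := by
      rcases hx2 with h | h
      · by_cases hxs : x ≤ s
        · exact Or.inr ⟨s, hs, hxs⟩
        · exact Or.inl (hsε ⟨by linarith, h⟩)
      · by_cases hxt : x ≤ t
        · exact Or.inr ⟨t, ht, hxt⟩
        · exact Or.inl (htδ ⟨by linarith, h⟩)
    rcases hlow with h | ⟨y, hy, hyx⟩
    · exact h
    rcases hup with h | ⟨z, hz, hxz⟩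
    · exact h
    exact key y hy z hz hyx hxz

theorem IsIntegralCurveOn.eqOn_of_contDiff (hF : ContDiff ℝ 1 F) {J : Set ℝ} (hJo : IsOpen J)
    (hJ : J.OrdConnected) {v w : ℝ → V} (hv : IsIntegralCurveOn v (fun _ => F) J)
    (hw : IsIntegralCurveOn w (fun _ => F) J) {t₀ : ℝ} (ht₀ : t₀ ∈ J) (h : v t₀ = w t₀) :
    Set.EqOn v w J := by
  intro t ht
  obtain ⟨a, b, h0, h1, hab⟩ := hJ.exists_Ioo_subset hJo ht₀ ht
  exact isMIntegralCurveOn_Ioo_eqOn_of_contMDiff_boundaryless (I := 𝓘(ℝ, V)) h0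
    hF.contMDiff_vectorField (isMIntegralCurveOn_iff_isIntegralCurveOn.2 (hv.mono hab))
    (isMIntegralCurveOn_iff_isIntegralCurveOn.2 (hw.mono hab)) h h1

theorem exists_isIntegralCurve_of_forall_Ioo (hF : ContDiff ℝ 1 F) {x : V}
    (h : ∀ T : ℝ, ∃ v : ℝ → V, v 0 = x ∧ IsIntegralCurveOn v (fun _ => F) (Set.Ioo (-T) T)) :
    ∃ v : ℝ → V, v 0 = x ∧ IsIntegralCurve v (fun _ => F) := by
  obtain ⟨v, hv0, hv⟩ := (exists_isMIntegralCurve_iff_exists_isMIntegralCurveOn_Ioo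
    hF.contMDiff_vectorField x).2 fun T => by
      obtain ⟨v, hv0, hv⟩ := h T
      exact ⟨v, hv0, isMIntegralCurveOn_iff_isIntegralCurveOn.2 hv⟩
  refine ⟨v, hv0, ?_⟩
  rw [← isIntegralCurveOn_univ]
  exact isMIntegralCurveOn_iff_isIntegralCurveOn.1 (hv.isMIntegralCurveOn _)

/-- A function that is differentiable along an interval, with vanishing derivative, is
constant. -/
theorem eqOn_const_of_hasDerivWithinAt_zero {W : Type*} [NormedAddCommGroup W] [NormedSpace ℝ W]
    {f : ℝ → W} {J : Set ℝ} (hJ : J.OrdConnected)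
    (hf : ∀ t ∈ J, HasDerivWithinAt f 0 J t) {s t : ℝ} (hs : s ∈ J) (ht : t ∈ J) :
    f s = f t := by
  have := hJ.convex.norm_image_sub_le_of_norm_hasDerivWithin_le (f := f) (f' := fun _ => 0)
    (C := 0) hf (by simp) hs ht
  rw [zero_mul, norm_le_zero_iff, sub_eq_zero] at this
  exact this.symm

theorem HasDerivWithinAt.linearMap_comp [FiniteDimensional ℝ V] {W : Type*}
    [NormedAddCommGroup W] [NormedSpace ℝ W] (l : V →ₗ[ℝ] W) {v : ℝ → V} {v' : V} {J : Set ℝ}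
    {t : ℝ} (h : HasDerivWithinAt v v' J t) :
    HasDerivWithinAt (fun t => l (v t)) (l v') J t :=
  (LinearMap.toContinuousLinearMap l).hasFDerivAt.comp_hasDerivWithinAt t h

theorem HasDerivAt.linearMap_comp [FiniteDimensional ℝ V] {W : Type*}
    [NormedAddCommGroup W] [NormedSpace ℝ W] (l : V →ₗ[ℝ] W) {v : ℝ → V} {v' : V} {t : ℝ}
    (h : HasDerivAt v v' t) : HasDerivAt (fun t => l (v t)) (l v') t :=
  (LinearMap.toContinuousLinearMap l).hasFDerivAt.comp_hasDerivAt t h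

/-- A vector field with compact support that is `C¹` has integral curves on all intervals. -/
theorem exists_isIntegralCurveOn_Icc_of_hasCompactSupport [CompleteSpace V]
    (hF : ContDiff ℝ 1 F) (hc : HasCompactSupport F) (x : V) {T : ℝ} (hT : 0 ≤ T) :
    ∃ v : ℝ → V, v 0 = x ∧ IsIntegralCurveOn v (fun _ => F) (Set.Icc (-T) T) := by
  obtain ⟨K, hK⟩ := ContDiff.lipschitzWith_of_hasCompactSupport hc hF one_ne_zero
  obtain ⟨C, hC⟩ := hF.continuous.bounded_above_of_compact_support hc
  have h0 : (0 : ℝ) ∈ Set.Icc (-T) T := ⟨by linarith, hT⟩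
  have hC0 : 0 ≤ C := (norm_nonneg _).trans (hC x)
  -- A solution moves at speed at most `C`, so it cannot leave the ball of radius `C * T` within
  -- time `T`; the Lipschitz constant is global. Hence one application covers the whole interval.
  have hPL : IsPicardLindelof (fun _ => F) (⟨0, h0⟩ : Set.Icc (-T) T) x
      (C.toNNReal * T.toNNReal) 0 C.toNNReal K :=
    { lipschitzOnWith := fun _ _ => hK.lipschitzOnWith
      continuousOn := fun _ _ => continuousOn_const
      norm_le := fun _ _ y _ => (hC y).trans (Real.le_coe_toNNReal C)
      mul_max_le := by
        simp [hC0, hT] }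
  obtain ⟨v, hv0, hv⟩ := hPL.exists_eq_forall_mem_Icc_hasDerivWithinAt₀
  exact ⟨v, hv0, hv⟩

/-- A vector field with a first integral whose level set through `x` is bounded has a global
integral curve through `x`. -/
theorem exists_isIntegralCurve_of_isBounded_levelSet [FiniteDimensional ℝ V]
    (hF : ContDiff ℝ 1 F) {N : V → ℝ} (hN : Differentiable ℝ N) (hNF : ∀ y, fderiv ℝ N y (F y) = 0)
    {x : V} (hb : Bornology.IsBounded (N ⁻¹' {N x})) :
    ∃ v : ℝ → V, v 0 = x ∧ IsIntegralCurve v (fun _ => F) := by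
  obtain ⟨R, hR0, hR⟩ := hb.subset_ball_lt 0 (0 : V)
  have := FiniteDimensional.complete ℝ V
  -- The cut-off is `1` on a ball containing the level set. Rescaling `F` keeps `N` conserved, so
  -- the solution of the cut-off equation stays where the cut-off does nothing.
  let χ : ContDiffBump (0 : V) := ⟨R, R + 1, hR0, by linarith⟩
  have hχF : ContDiff ℝ 1 (fun y => χ y • F y) := χ.contDiff.smul hF
  have hχc : HasCompactSupport (fun y => χ y • F y) := χ.hasCompactSupport.smul_right
  refine exists_isIntegralCurve_of_forall_Ioo hF fun T => ?_
  obtain ⟨v, hv0, hv⟩ := exists_isIntegralCurveOn_Icc_of_hasCompactSupport hχF hχc x (abs_nonneg T)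
  refine ⟨v, hv0, ?_⟩
  have hsub : Set.Ioo (-T) T ⊆ Set.Icc (-|T|) |T| := fun t ht =>
    ⟨by linarith [ht.1, le_abs_self T], by linarith [ht.2, le_abs_self T]⟩
  have hconst : ∀ t ∈ Set.Icc (-|T|) |T|, N (v t) = N x := by
    intro t ht
    rw [← hv0]
    refine eqOn_const_of_hasDerivWithinAt_zero (f := fun t => N (v t)) Set.ordConnected_Icc
      (fun s hs => ?_) ht ⟨by simp, abs_nonneg T⟩
    have := (hN (v s)).hasFDerivAt.comp_hasDerivWithinAt s (hv s hs)
    rwa [map_smul, hNF, smul_zero] at this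
  intro t ht
  have h1 : χ (v t) = 1 := by
    refine χ.one_of_mem_closedBall (Metric.ball_subset_closedBall (hR ?_))
    exact hconst t (hsub ht)
  have := (hv t (hsub ht)).mono hsub
  beta_reduce at this
  rwa [h1, one_smul] at this

/-- If `u 0 > 0`, then `u⁻¹ + t` is conserved on `[0, ∞)`, which forces `u⁻¹` to vanish at `t = (u
0)⁻¹`. -/
theorem not_hasDerivAt_sq {u : ℝ → ℝ} (hu : ∀ t, HasDerivAt u (u t ^ 2) t) : u 0 ≤ 0 := by
  by_contra! h0
  have hmono : Monotone u := monotone_of_deriv_nonneg (fun t => (hu t).differentiableAt)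
    fun t => by rw [(hu t).deriv]; positivity
  have hpos : ∀ t ∈ Set.Ici (0 : ℝ), 0 < u t := fun t ht => h0.trans_le (hmono ht)
  have hconst : (fun t => (u t)⁻¹ + t) 0 = (fun t => (u t)⁻¹ + t) (u 0)⁻¹ := by
    refine eqOn_const_of_hasDerivWithinAt_zero (f := fun t => (u t)⁻¹ + t) (J := Set.Ici 0) Set.ordConnected_Ici
      (fun t ht => ?_) (Set.mem_Ici.2 le_rfl) (inv_nonneg.2 h0.le)
    have hne := (hpos t ht).ne'
    have := ((hu t).inv hne).add (hasDerivAt_id t)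
    refine HasDerivAt.hasDerivWithinAt ?_
    convert! this using 1
    field_simp
    ring
  have := inv_pos.2 (hpos (u 0)⁻¹ (inv_nonneg.2 h0.le))
  simp only [add_zero] at hconst
  linarith

/-- The integral curve of a quadratic vector field through an idempotent is not defined for all
times. -/
theorem not_isIntegralCurve_of_isIdempotentOf (hF : ContDiff ℝ 1 F)
    (hF2 : ∀ (c : ℝ) (x : V), F (c • x) = c ^ 2 • F x) {x : V} (hx : IsIdempotentOf F x)
    {v : ℝ → V} (hv0 : v 0 = x) : ¬ IsIntegralCurve v (fun _ => F) := by
  intro hv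
  have hw : IsIntegralCurveOn (fun t => (1 - t)⁻¹ • x) (fun _ => F) (Set.Iio 1) := by
    intro t ht
    have hne : 1 - t ≠ 0 := sub_ne_zero.2 (ne_of_gt ht)
    have := (((hasDerivAt_id t).const_sub 1).inv hne).smul_const x
    refine HasDerivAt.hasDerivWithinAt ?_
    convert! this using 1
    beta_reduce
    rw [hF2, hx.2]
    simp
  have heq := (hv.isIntegralCurveOn (Set.Iio 1)).eqOn_of_contDiff hF isOpen_Iio
    Set.ordConnected_Iio hw (t₀ := 0) (by simp) (by simp [hv0])
  have hcont := hv.continuous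
  -- As `t` increases to `1`, continuity of `v` sends `(1 - t) • v t` to `0`, while the explicit
  -- solution makes it constantly `x`.
  have hlim : Filter.Tendsto (fun t : ℝ => (1 - t) • v t) (nhdsWithin 1 (Set.Iio 1))
      (nhds ((1 - 1 : ℝ) • v 1)) :=
    (((continuous_const.sub continuous_id).smul hcont).tendsto 1).mono_left nhdsWithin_le_nhds
  have hlim' : Filter.Tendsto (fun t : ℝ => (1 - t) • v t) (nhdsWithin 1 (Set.Iio 1)) (nhds x) := by
    refine tendsto_const_nhds.congr' ?_
    filter_upwards [self_mem_nhdsWithin] with t ht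
    have hne : 1 - t ≠ 0 := sub_ne_zero.2 (ne_of_gt ht)
    rw [heq ht, smul_smul, mul_inv_cancel₀ hne, one_smul]
  have := tendsto_nhds_unique hlim hlim'
  rw [sub_self, zero_smul] at this
  exact hx.1 this.symm

end Curves

/-! ### Bilinear forms in finite dimension. -/

section Bilinear

variable {V : Type*} [NormedAddCommGroup V] [NormedSpace ℝ V] [FiniteDimensional ℝ V]

theorem LinearMap.BilinForm.IsSymm.hasFDerivAt_apply_self {b : LinearMap.BilinForm ℝ V}
    (hb : b.IsSymm) (x : V) :
    HasFDerivAt (fun y => b y y) (LinearMap.toContinuousLinearMap ((2 : ℝ) • b x)) x := by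
  let T : V →ₗ[ℝ] V →L[ℝ] ℝ :=
    (LinearMap.toContinuousLinearMap : (V →ₗ[ℝ] ℝ) ≃ₗ[ℝ] _).toLinearMap ∘ₗ b
  have := (LinearMap.toContinuousLinearMap T).hasFDerivAt.clm_apply (hasFDerivAt_id x)
  refine this.congr_fderiv ?_
  ext w
  change b x w + b w x = 2 * b x w
  rw [hb.eq w x]
  ring

/-- The level sets of a positive definite form are bounded. -/
theorem isBounded_levelSet_of_pos {b : LinearMap.BilinForm ℝ V} (hb : b.IsSymm)
    (hpos : ∀ x, x ≠ 0 → 0 < b x x) (r : ℝ) : Bornology.IsBounded ((fun x => b x x) ⁻¹' {r}) := by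
  have hcont : Continuous fun x => b x x :=
    continuous_iff_continuousAt.2 fun x => (hb.hasFDerivAt_apply_self x).continuousAt
  -- The sphere is empty exactly when `V` is trivial. Otherwise the minimum of the form on it is a
  -- coercivity constant.
  rcases (Metric.sphere (0 : V) 1).eq_empty_or_nonempty with he | hne
  · refine (Bornology.isBounded_singleton (x := (0 : V))).subset fun x _ => ?_
    by_contra hx
    have : ‖x‖⁻¹ • x ∈ Metric.sphere (0 : V) 1 := by
      rw [mem_sphere_zero_iff_norm, norm_smul, norm_inv, norm_norm,
        inv_mul_cancel₀ (norm_ne_zero_iff.2 hx)]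
    rw [he] at this
    exact this
  obtain ⟨x₀, hx₀, hmin⟩ := (isCompact_sphere (0 : V) 1).exists_isMinOn hne hcont.continuousOn
  have hx₀0 : x₀ ≠ 0 := by
    rintro rfl
    simp at hx₀
  have hm := hpos x₀ hx₀0
  have hle : ∀ x : V, ‖x‖ ^ 2 * b x₀ x₀ ≤ b x x := by
    intro x
    by_cases hx : x = 0
    · simp [hx]
    have hn := norm_ne_zero_iff.2 hx
    have hmem : ‖x‖⁻¹ • x ∈ Metric.sphere (0 : V) 1 := by
      rw [mem_sphere_zero_iff_norm, norm_smul, norm_inv, norm_norm, inv_mul_cancel₀ hn]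
    have := hmin hmem
    simp only [Set.mem_ofPred_eq, map_smul, LinearMap.smul_apply, smul_eq_mul] at this
    have hn2 : 0 < ‖x‖ ^ 2 := by positivity
    calc ‖x‖ ^ 2 * b x₀ x₀ ≤ ‖x‖ ^ 2 * (‖x‖⁻¹ * (‖x‖⁻¹ * b x x)) :=
          mul_le_mul_of_nonneg_left this hn2.le
      _ = b x x := by field_simp
  refine isBounded_iff_forall_norm_le.2 ⟨√(r / b x₀ x₀), fun x hx => ?_⟩
  have hx' : b x x = r := hx
  refine Real.le_sqrt_of_sq_le ?_
  rw [le_div_iff₀ hm, ← hx']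
  exact hle x

theorem LinearMap.BilinForm.Nondegenerate.exists_apply_eq {q : LinearMap.BilinForm ℝ V} (hq : q.Nondegenerate) (l : V →ₗ[ℝ] ℝ) :
    ∃ x, ∀ y, q x y = l y :=
  ⟨(q.toDual hq).symm l, fun y => by
    rw [← LinearMap.BilinForm.toDual_def hq, LinearEquiv.apply_symm_apply]⟩

end Bilinear

/-! ### Completeness and boundedness in the four cases. -/

namespace AffRSumR

variable {q : LinearMap.BilinForm ℝ AffRSumR}

theorem geodesicField_smul (hq : q.Nondegenerate) (c : ℝ) (v : AffRSumR) :
    geodesicField q hq (c • v) = c ^ 2 • geodesicField q hq v := by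
  simp only [geodesicField_eq_adTranspose, map_smul, LinearMap.smul_apply, smul_smul, sq]

theorem not_complete_of_spacelike (hq : IsLorentzian q) (hZ : 0 < q Z Z) :
    ¬ ∀ x, ∃ v : ℝ → AffRSumR, v 0 = x ∧
      IsIntegralCurve v (fun _ => geodesicField q hq.nondegenerate) := by
  intro h
  obtain ⟨x, hx⟩ := exists_isIdempotentOf_geodesicField hq hZ
  obtain ⟨v, hv0, hv⟩ := h x
  exact not_isIntegralCurve_of_isIdempotentOf (contDiff_geodesicField _)
    (geodesicField_smul _) hx hv0 hv

/-- A first integral of the geodesic field, which is positive definite when the center is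
timelike. -/
def firstIntegral (q : LinearMap.BilinForm ℝ AffRSumR) : LinearMap.BilinForm ℝ AffRSumR :=
  q - (2 / q Z Z) • LinearMap.BilinForm.linMulLin (q.flip Z) (q.flip Z)

theorem firstIntegral_apply (v w : AffRSumR) :
    firstIntegral q v w = q v w - 2 / q Z Z * (q v Z * q w Z) := rfl

theorem firstIntegral_isSymm (hs : q.IsSymm) : (firstIntegral q).IsSymm :=
  ⟨fun v w => by rw [firstIntegral_apply, firstIntegral_apply, hs.eq v w, mul_comm (q v Z)]⟩

theorem firstIntegral_pos (hq : IsLorentzian q) (hZ : q Z Z < 0) {v : AffRSumR} (hv : v ≠ 0) :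
    0 < firstIntegral q v v := by
  have := pos_of_timelike hq hZ hv
  rw [firstIntegral_apply]
  convert this using 2
  ring

theorem firstIntegral_geodesicField (hs : q.IsSymm) (hq : q.Nondegenerate) (v : AffRSumR) :
    firstIntegral q v (geodesicField q hq v) = 0 := by
  rw [firstIntegral_apply, apply_geodesicField_Z, hs.eq, apply_geodesicField_self]
  simp

theorem complete_of_timelike (hq : IsLorentzian q) (hZ : q Z Z < 0) (x : AffRSumR) :
    ∃ v : ℝ → AffRSumR, v 0 = x ∧
      IsIntegralCurve v (fun _ => geodesicField q hq.nondegenerate) := by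
  have hd := (firstIntegral_isSymm hq.isSymm).hasFDerivAt_apply_self
  refine exists_isIntegralCurve_of_isBounded_levelSet (contDiff_geodesicField _)
    (N := fun v => firstIntegral q v v) (fun y => (hd y).differentiableAt) (fun y => ?_)
    (isBounded_levelSet_of_pos (firstIntegral_isSymm hq.isSymm)
      (fun _ => firstIntegral_pos hq hZ) _)
  rw [(hd y).fderiv]
  change 2 * firstIntegral q y _ = 0
  rw [firstIntegral_geodesicField hq.isSymm, mul_zero]

theorem isBounded_of_timelike (hq : IsLorentzian q) (hZ : q Z Z < 0) {v : ℝ → AffRSumR}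
    {J : Set ℝ} (hv : IsIntegralCurveOnInterval (geodesicField q hq.nondegenerate) v J) :
    Bornology.IsBounded (v '' J) := by
  obtain ⟨t₀, ht₀⟩ := hv.nonempty
  have hd := (firstIntegral_isSymm hq.isSymm).hasFDerivAt_apply_self
  refine (isBounded_levelSet_of_pos (firstIntegral_isSymm hq.isSymm)
    (fun _ => firstIntegral_pos hq hZ) (firstIntegral q (v t₀) (v t₀))).subset ?_
  rintro _ ⟨t, ht, rfl⟩
  refine eqOn_const_of_hasDerivWithinAt_zero (f := fun t => firstIntegral q (v t) (v t))
    hv.ordConnected (fun s hs => ?_) ht ht₀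
  have := (hd (v s)).comp_hasDerivWithinAt s (hv.isIntegralCurveOn s hs)
  convert! this using 1
  change 0 = 2 * firstIntegral q (v s) _
  rw [firstIntegral_geodesicField hq.isSymm, mul_zero]

/-- On the level `q(v, Z) = 1` one has `q(v, W)' = -q(v, B)` and `q(v, B)' = 2 u q(v, B)`, where `u
= α q(v, W) - β`. Hence `-α q(v, B) - u²` is conserved, and on its zero level `u' = u²`. -/
theorem not_complete_of_lightlike_of_not_orthogonal (hs : q.IsSymm) (hq : q.Nondegenerate)
    (hZ : q Z Z = 0) (hZB : q Z B ≠ 0) :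
    ¬ ∀ x, ∃ v : ℝ → AffRSumR, v 0 = x ∧ IsIntegralCurve v (fun _ => geodesicField q hq) := by
  intro hcomplete
  obtain ⟨W, hW⟩ : ∃ W, W = q Z B • A - q Z A • B := ⟨_, rfl⟩
  have hqW : ∀ x, q x W = q Z B * q x A - q Z A * q x B := fun x => by
    rw [hW, map_sub, map_smul, map_smul, smul_eq_mul, smul_eq_mul]
  have hZW : q Z W = 0 := by rw [hqW]; ring
  have hD : q W W ≠ 0 := by
    intro h
    have h1 : W = (q W B / q Z B) • Z := by
      have hB : q W B = q ((q W B / q Z B) • Z) B := by simp [hZB]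
      refine ext_of_apply hq ?_ hB ?_
      · have h2 := hqW W
        rw [h] at h2
        simp only [map_smul, LinearMap.smul_apply, smul_eq_mul]
        field_simp
        linear_combination -h2
      · rw [hs.eq, hZW]
        simp [hZ]
    have h2 := congrArg fstₗ h1
    rw [hW] at h2
    simp [hZB] at h2
  have ha : ∀ v, fstₗ v * q W W = q Z B * q v W - q B W * q v Z := by
    intro v
    have e1 : q v W = fstₗ v * q A W + sndₗ v * q B W := by
      rw [apply_eq_left q v W, hZW, mul_zero, add_zero]
    have e2 : q v Z = fstₗ v * q Z A + sndₗ v * q Z B := by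
      rw [apply_eq_left q v Z, hZ, hs.eq A, hs.eq B]
      ring
    have e3 : q W W = q Z B * q A W - q Z A * q B W := by
      rw [hs.eq A, hs.eq B, hqW W]
    rw [e1, e2, e3]
    ring
  obtain ⟨α, hα⟩ : ∃ α, α = q Z B / (2 * q W W) := ⟨_, rfl⟩
  have hα0 : α ≠ 0 := by
    rw [hα]
    exact div_ne_zero hZB (mul_ne_zero two_ne_zero hD)
  obtain ⟨β, hβ⟩ : ∃ β, β = q B W / (2 * q W W) := ⟨_, rfl⟩
  have ha' : ∀ v, fstₗ v = 2 * (α * q v W) - 2 * (β * q v Z) := by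
    intro v
    have := ha v
    rw [hα, hβ]
    field_simp
    linear_combination this
  -- The pairings of `x` are prescribed so that `q x Z = 1`, `u(0) = 1` and the conserved quantity
  -- is `0`.
  obtain ⟨x, hx⟩ := hq.exists_apply_eq
    ((((1 + β) / α - q Z A / α) / q Z B) • fstₗ + (-1 / α) • sndₗ + (1 : ℝ) • thdₗ)
  have hxA : q x A = ((1 + β) / α - q Z A / α) / q Z B := by rw [hx]; simp
  have hxB : q x B = -1 / α := by rw [hx]; simp
  have hxZ : q x Z = 1 := by rw [hx]; simp
  have hxW : q x W = (1 + β) / α := by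
    rw [hqW, hxA, hxB]
    field_simp
    ring
  obtain ⟨v, hv0, hv⟩ := hcomplete x
  have hd : ∀ w t, HasDerivAt (fun t => q (v t) w) (q (geodesicField q hq (v t)) w) t :=
    fun w t => (hv t).linearMap_comp (q.flip w)
  have hk : ∀ t, q (v t) Z = 1 := by
    intro t
    rw [← hxZ, ← hv0]
    refine eqOn_const_of_hasDerivWithinAt_zero (f := fun t => q (v t) Z) Set.ordConnected_univ
      (fun s _ => ?_) (Set.mem_univ t) (Set.mem_univ 0)
    have := hd Z s
    rw [apply_geodesicField_Z] at this
    exact this.hasDerivWithinAt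
  have hdW : ∀ t, HasDerivAt (fun t => q (v t) W) (-q (v t) B) t := by
    intro t
    have := hd W t
    rw [hqW, apply_geodesicField_A, apply_geodesicField_B] at this
    convert! this using 1
    have h1 := hk t
    rw [apply_eq_left q (v t) Z, hZ, hs.eq A, hs.eq B] at h1
    linear_combination q (v t) B * h1
  have hdB : ∀ t, HasDerivAt (fun t => q (v t) B) (fstₗ (v t) * q (v t) B) t := by
    intro t
    have := hd B t
    rwa [apply_geodesicField_B] at this
  have hE : ∀ t, -(α * q (v t) B) = (α * q (v t) W - β) ^ 2 := by
    intro t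
    have h0 : (fun t => -(α * q (v t) B) - (α * q (v t) W - β) ^ 2) t =
        (fun t => -(α * q (v t) B) - (α * q (v t) W - β) ^ 2) 0 := by
      refine eqOn_const_of_hasDerivWithinAt_zero
        (f := fun t => -(α * q (v t) B) - (α * q (v t) W - β) ^ 2) Set.ordConnected_univ
        (fun s _ => ?_) (Set.mem_univ t) (Set.mem_univ 0)
      have := ((hdB s).const_mul α).neg.sub ((((hdW s).const_mul α).sub_const β).pow 2)
      refine HasDerivAt.hasDerivWithinAt ?_
      convert! this using 1
      rw [ha', hk]
      simp
      ring
    simp only [hv0, hxB, hxW] at h0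
    have h1 : -(α * (-1 / α)) - (α * ((1 + β) / α) - β) ^ 2 = 0 := by
      field_simp
      ring
    linarith
  have hu := not_hasDerivAt_sq (u := fun t => α * q (v t) W - β) fun t => by
    have := ((hdW t).const_mul α).sub_const β
    convert! this using 1
    rw [← hE]
    ring
  simp only [hv0, hxW] at hu
  have : α * ((1 + β) / α) - β = 1 := by field_simp; ring
  linarith

/-- The integral curves of the geodesic field when the center is lightlike and orthogonal to the
derived subalgebra. -/
def orthogonalCurve (q : LinearMap.BilinForm ℝ AffRSumR) (x : AffRSumR) (t : ℝ) : AffRSumR :=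
  x + (q x B * (Real.exp (fstₗ x * t) - 1) / q B B) • B -
    (q x B ^ 2 / (q Z A * q B B) * ∫ s in (0 : ℝ)..t, Real.exp (fstₗ x * s) ^ 2) • Z

theorem orthogonalCurve_zero (x : AffRSumR) : orthogonalCurve q x 0 = x := by
  simp [orthogonalCurve]

theorem fstₗ_orthogonalCurve (x : AffRSumR) (t : ℝ) : fstₗ (orthogonalCurve q x t) = fstₗ x := by
  simp [orthogonalCurve]

theorem apply_orthogonalCurve_B (hB : q B B ≠ 0) (hZB : q Z B = 0) (x : AffRSumR) (t : ℝ) :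
    q (orthogonalCurve q x t) B = q x B * Real.exp (fstₗ x * t) := by
  simp only [orthogonalCurve, map_add, map_sub, map_smul, LinearMap.add_apply,
    LinearMap.sub_apply, LinearMap.smul_apply, smul_eq_mul, hZB]
  field_simp
  ring

theorem isIntegralCurve_orthogonalCurve (hs : q.IsSymm) (hq : q.Nondegenerate) (hZ : q Z Z = 0)
    (hZB : q Z B = 0) (x : AffRSumR) :
    IsIntegralCurve (orthogonalCurve q x) (fun _ => geodesicField q hq) := by
  obtain ⟨hA, hB⟩ := ne_zero_of_orthogonal hs hq hZ hZB
  intro t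
  beta_reduce
  rw [geodesicField_of_orthogonal hs hq hZ hZB, apply_orthogonalCurve_B hB hZB,
    fstₗ_orthogonalCurve]
  have hlin : HasDerivAt (fun t => fstₗ x * t) (fstₗ x) t := by
    simpa using (hasDerivAt_id t).const_mul (fstₗ x)
  have h1 := (((hlin.exp.sub_const 1).const_mul (q x B)).div_const (q B B)).smul_const B
  have hcont : Continuous fun s : ℝ => Real.exp (fstₗ x * s) ^ 2 := by fun_prop
  have h2 := ((hcont.integral_hasStrictDerivAt 0 t).hasDerivAt.const_mul
    (q x B ^ 2 / (q Z A * q B B))).smul_const Z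
  have h3 := (h1.const_add x).sub h2
  refine h3.congr_deriv ?_
  congr 2 <;> ring

theorem not_isBounded_of_orthogonal (hs : q.IsSymm) (hq : q.Nondegenerate) (hZ : q Z Z = 0)
    (hZB : q Z B = 0) {v : ℝ → AffRSumR} {J : Set ℝ}
    (hv : IsMaximalIntegralCurve (geodesicField q hq) v J) (hst : ¬ IsStationaryOn v J) :
    ¬ Bornology.IsBounded (v '' J) := by
  obtain ⟨hA, hB⟩ := ne_zero_of_orthogonal hs hq hZ hZB
  obtain ⟨hvJ, hmax⟩ := hv
  obtain ⟨t₀, ht₀⟩ := hvJ.nonempty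
  generalize hx : v t₀ = x
  have hw : IsIntegralCurve (fun t => orthogonalCurve q x (t - t₀)) (fun _ => geodesicField q hq) :=
    fun t => by
      have := (isIntegralCurve_orthogonalCurve hs hq hZ hZB x (t - t₀)).scomp t
        ((hasDerivAt_id t).sub_const t₀)
      rwa [one_smul] at this
  have heq : Set.EqOn v (fun t => orthogonalCurve q x (t - t₀)) J :=
    hvJ.isIntegralCurveOn.eqOn_of_contDiff (contDiff_geodesicField hq) hvJ.isOpen
      hvJ.ordConnected (hw.isIntegralCurveOn J) ht₀ (by simp [orthogonalCurve_zero, hx])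
  -- The explicit solution is global, so maximality forces the domain to be all of `ℝ`.
  have hJ : J = Set.univ := (hmax _ Set.univ
    ⟨Set.univ_nonempty, isOpen_univ, Set.ordConnected_univ, hw.isIntegralCurveOn _⟩
    (Set.subset_univ J) heq).symm
  subst hJ
  intro hb
  have hbound : ∀ l : AffRSumR →ₗ[ℝ] ℝ, ∃ C, ∀ t, |l (orthogonalCurve q x t)| ≤ C := by
    intro l
    obtain ⟨C, hC⟩ := isBounded_iff_forall_norm_le.1 hb
    refine ⟨‖LinearMap.toContinuousLinearMap l‖ * C, fun t => ?_⟩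
    have h1 : orthogonalCurve q x t ∈ v '' Set.univ :=
      ⟨t + t₀, Set.mem_univ _, by rw [heq (Set.mem_univ _)]; simp⟩
    exact ((LinearMap.toContinuousLinearMap l).le_opNorm _).trans
      (mul_le_mul_of_nonneg_left (hC _ h1) (norm_nonneg _))
  have hy : q x B ≠ 0 := by
    intro hy
    refine hst ⟨x, fun t ht => ?_⟩
    rw [heq ht]
    simp [orthogonalCurve, hy]
  -- With zero `A`-coordinate the `Z`-coordinate is affine in `t` with nonzero slope; otherwise
  -- `q(v, B)` is a nonconstant exponential.
  by_cases ha : fstₗ x = 0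
  · obtain ⟨C, hC⟩ := hbound thdₗ
    have hθ : ∀ t, thdₗ (orthogonalCurve q x t) =
        thdₗ x - q x B ^ 2 / (q Z A * q B B) * t := by
      intro t
      simp [orthogonalCurve, ha]
    generalize hκ : q x B ^ 2 / (q Z A * q B B) = κ at hθ
    have hκ0 : κ ≠ 0 := by
      rw [← hκ]
      exact div_ne_zero (pow_ne_zero 2 hy) (mul_ne_zero hA hB)
    have := hC ((thdₗ x - (C + 1)) / κ)
    rw [hθ, mul_div_cancel₀ _ hκ0] at this
    have := (le_abs_self _).trans this
    linarith
  · obtain ⟨C, hC⟩ := hbound (q.flip B)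
    have := hC ((C / |q x B|) / fstₗ x)
    rw [LinearMap.BilinForm.flip_apply, apply_orthogonalCurve_B hB hZB, mul_div_cancel₀ _ ha,
      abs_mul, Real.abs_exp] at this
    have h1 := Real.add_one_le_exp (C / |q x B|)
    have h2 := abs_pos.2 hy
    have h3 := mul_le_mul_of_nonneg_left h1 h2.le
    rw [mul_add, mul_div_cancel₀ _ h2.ne'] at h3
    linarith

end AffRSumR

/-! ### Left translations and the Maurer-Cartan form. -/

section LieGroup

variable {E : Type*} [NormedAddCommGroup E] [NormedSpace ℝ E]
  {G : Type*} [TopologicalSpace G] [ChartedSpace E G] [Group G]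

instance [FiniteDimensional ℝ E] : FiniteDimensional ℝ (GroupLieAlgebra 𝓘(ℝ, E) G) :=
  inferInstanceAs (FiniteDimensional ℝ E)

instance : T2Space (GroupLieAlgebra 𝓘(ℝ, E) G) := inferInstanceAs (T2Space E)

/-- The Maurer-Cartan form: left translation of tangent vectors to the identity. -/
def maurerCartan (p : G) : TangentSpace 𝓘(ℝ, E) p →L[ℝ] GroupLieAlgebra 𝓘(ℝ, E) G :=
  mfderiv 𝓘(ℝ, E) 𝓘(ℝ, E) (fun x : G => p⁻¹ * x) p

/-- Left translation of tangent vectors at the identity. -/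
def leftTranslation (p : G) : GroupLieAlgebra 𝓘(ℝ, E) G →L[ℝ] TangentSpace 𝓘(ℝ, E) p :=
  mfderiv 𝓘(ℝ, E) 𝓘(ℝ, E) (fun x : G => p * x) 1

theorem leftTranslation_apply (p : G) (v : GroupLieAlgebra 𝓘(ℝ, E) G) :
    leftTranslation p v = mulInvariantVectorField v p := rfl

theorem tangentBundle_mk_eq {a b : G} (h : a = b) (u : E) :
    (⟨a, u⟩ : TangentBundle 𝓘(ℝ, E) G) = ⟨b, u⟩ := by
  subst h
  rfl

/-- The derivative of the left multiplication by `a` at `b`, as an endomorphism of the model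
space. -/
def mulLeftDeriv (a b : G) : E →L[ℝ] E :=
  mfderiv 𝓘(ℝ, E) 𝓘(ℝ, E) (fun x : G => a * x) b

theorem leftInvariantMetric_apply (q : LinearMap.BilinForm ℝ (GroupLieAlgebra 𝓘(ℝ, E) G)) (p : G)
    (u w : TangentSpace 𝓘(ℝ, E) p) :
    leftInvariantMetric q p u w = q (maurerCartan p u) (maurerCartan p w) := rfl

theorem mulLeftDeriv_one (c : G) (u : E) : mulLeftDeriv (1 : G) c u = u := by
  have h : (fun x : G => 1 * x) = id := by
    ext x
    simp
  rw [mulLeftDeriv, h, mfderiv_id]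
  rfl

variable [LieGroup 𝓘(ℝ, E) ∞ G]

theorem mdifferentiableAt_leftMul {a b : G} :
    MDifferentiableAt 𝓘(ℝ, E) 𝓘(ℝ, E) (fun x : G => a * x) b :=
  (contMDiff_mul_left (I := 𝓘(ℝ, E)) (n := ∞)).mdifferentiable (by simp) b

theorem mulLeftDeriv_comp (a b c : G) (u : E) :
    mulLeftDeriv a (b * c) (mulLeftDeriv b c u) = mulLeftDeriv (a * b) c u := by
  have h : (fun x : G => a * b * x) = (fun x => a * x) ∘ fun x => b * x := by
    ext x
    simp [mul_assoc]
  have := congrArg (fun f : E →L[ℝ] E => f u) (mfderiv_comp c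
    (mdifferentiableAt_leftMul (E := E) (a := a)) (mdifferentiableAt_leftMul (E := E) (a := b)))
  rw [← h] at this
  exact this.symm

theorem mulLeftDeriv_inv_mulLeftDeriv (p : G) (v : E) :
    mulLeftDeriv p⁻¹ p (mulLeftDeriv p 1 v) = v := by
  have h := mulLeftDeriv_comp p⁻¹ p 1 v
  rwa [mul_one, inv_mul_cancel, mulLeftDeriv_one] at h

theorem mulLeftDeriv_mulLeftDeriv_inv (p : G) (v : E) :
    mulLeftDeriv p 1 (mulLeftDeriv p⁻¹ p v) = v := by
  have h := mulLeftDeriv_comp p p⁻¹ p v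
  rwa [inv_mul_cancel, mul_inv_cancel, mulLeftDeriv_one] at h

theorem maurerCartan_mulInvariantVectorField (p : G) (v : GroupLieAlgebra 𝓘(ℝ, E) G) :
    maurerCartan p (mulInvariantVectorField v p) = v :=
  mulLeftDeriv_inv_mulLeftDeriv (E := E) p v

theorem mulInvariantVectorField_maurerCartan (p : G) (u : TangentSpace 𝓘(ℝ, E) p) :
    mulInvariantVectorField (maurerCartan p u) p = u :=
  mulLeftDeriv_mulLeftDeriv_inv (E := E) p u

theorem mfderiv_mul_left_mulInvariantVectorField (a p : G) (v : GroupLieAlgebra 𝓘(ℝ, E) G) :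
    mfderiv 𝓘(ℝ, E) 𝓘(ℝ, E) (fun x : G => a * x) p (mulInvariantVectorField v p) =
      mulInvariantVectorField v (a * p) := by
  have h := mulLeftDeriv_comp (E := E) a p 1 v
  rw [mul_one] at h
  exact h

/-- It expresses `dL_a` through the tangent map of the multiplication, so that smooth dependence on
`a` follows from smoothness of that map. -/
theorem mfderiv_mul_apply_zero_left (a b : G) (u : E) :
    (mfderiv (𝓘(ℝ, E).prod 𝓘(ℝ, E)) 𝓘(ℝ, E) (fun x : G × G => x.1 * x.2) (a, b) : E × E →L[ℝ] E)
      (0, u) = mulLeftDeriv a b u := by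
  have h := mfderiv_prod_eq_add_apply (I := 𝓘(ℝ, E)) (I' := 𝓘(ℝ, E)) (I'' := 𝓘(ℝ, E))
    (f := fun x : G × G => x.1 * x.2) (p := (a, b)) (v := ((0, u) : E × E))
    ((contMDiff_mul 𝓘(ℝ, E) ∞).mdifferentiable (by simp) _)
  refine h.trans ?_
  have h0 : (mfderiv 𝓘(ℝ, E) 𝓘(ℝ, E) (fun z : G => z * b) a : E →L[ℝ] E) 0 = 0 := map_zero _
  refine Eq.trans (congrArg₂ (· + ·) h0 rfl) ?_
  exact zero_add _

/-- The map `(p, u, a) ↦ dL_a u`, on tangent bundles. -/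
theorem contMDiff_tangentMap_mul :
    ContMDiff (𝓘(ℝ, E).prod 𝓘(ℝ, E)).tangent 𝓘(ℝ, E).tangent 1
      (tangentMap (𝓘(ℝ, E).prod 𝓘(ℝ, E)) 𝓘(ℝ, E) (fun x : G × G => x.1 * x.2)) :=
  (contMDiff_mul 𝓘(ℝ, E) ∞).contMDiff_tangentMap (m := 1) (by rw [one_add_one_eq_two]; exact ENat.LEInfty.out)

theorem tangentBundle_trivializationAt_self (p : G) (u : E) :
    (trivializationAt E (TangentSpace 𝓘(ℝ, E) : G → Type _) p ⟨p, u⟩).2 = u := by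
  have h := tangentCoordChange_self (I := 𝓘(ℝ, E)) (x := p) (z := p) (v := u)
    (mem_extChartAt_source p)
  exact h

theorem mdifferentiableAt_maurerCartan {σ : ∀ p : G, TangentSpace 𝓘(ℝ, E) p} {p : G}
    (hσ : MDiffAt (T% σ) p) :
    MDifferentiableAt 𝓘(ℝ, E) 𝓘(ℝ, E) (M' := E) (fun x : G => maurerCartan x (σ x)) p := by
  have h0 : MDifferentiableAt 𝓘(ℝ, E) 𝓘(ℝ, E).tangent
      (fun x : G => (⟨x⁻¹, (0 : E)⟩ : TangentBundle 𝓘(ℝ, E) G)) p := by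
    have hz := Bundle.mdifferentiable_zeroSection ℝ (TangentSpace 𝓘(ℝ, E) : G → Type _)
      (IB := 𝓘(ℝ, E)) (F := E)
    exact (hz p⁻¹).comp p
      ((contMDiff_inv 𝓘(ℝ, E) ∞).mdifferentiable (by simp) p)
  have h1 := ((contMDiff_equivTangentBundleProd_symm (I := 𝓘(ℝ, E)) (M := G) (I' := 𝓘(ℝ, E))
    (M' := G) (n := 1)).mdifferentiable (by simp) _).comp p (h0.prodMk hσ)
  have h2 := ((contMDiff_tangentMap_mul (E := E) (G := G)).mdifferentiable (by simp) _).comp p h1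
  -- The differential of the multiplication sends `(0, σ x)` over `(x⁻¹, x)` to a vector over the
  -- constant point `1`, where the fibre coordinate is the vector itself.
  have h3 : MDifferentiableAt 𝓘(ℝ, E) 𝓘(ℝ, E).tangent
      (fun x : G => (⟨1, maurerCartan x (σ x)⟩ : TangentBundle 𝓘(ℝ, E) G)) p := by
    refine h2.congr_of_eventuallyEq (Filter.Eventually.of_forall fun x => ?_)
    refine (tangentBundle_mk_eq (inv_mul_cancel x).symm _).trans ?_
    exact congrArg (Bundle.TotalSpace.mk (x⁻¹ * x))
      (mfderiv_mul_apply_zero_left (E := E) x⁻¹ x (σ x)).symm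
  rw [mdifferentiableAt_totalSpace] at h3
  refine h3.2.congr_of_eventuallyEq (Filter.Eventually.of_forall fun x => ?_)
  exact (tangentBundle_trivializationAt_self 1 _).symm

end LieGroup

/-! ### The Levi-Civita connection of a left-invariant metric. -/

section LeviCivita

variable {E : Type*} [NormedAddCommGroup E] [NormedSpace ℝ E]
  {G : Type*} [TopologicalSpace G] [ChartedSpace E G] [Group G]

theorem mvfderiv_bilinear [FiniteDimensional ℝ E] (b : E →ₗ[ℝ] E →ₗ[ℝ] ℝ) {f h : G → E} {p : G}
    (hf : MDifferentiableAt 𝓘(ℝ, E) 𝓘(ℝ, E) f p) (hh : MDifferentiableAt 𝓘(ℝ, E) 𝓘(ℝ, E) h p)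
    (u : TangentSpace 𝓘(ℝ, E) p) :
    mvfderiv 𝓘(ℝ, E) (fun x => b (f x) (h x)) p u =
      b (mvfderiv 𝓘(ℝ, E) f p u) (h p) + b (f p) (mvfderiv 𝓘(ℝ, E) h p u) := by
  let T : E →L[ℝ] E →L[ℝ] ℝ := LinearMap.toContinuousLinearMap
    ((LinearMap.toContinuousLinearMap : (E →ₗ[ℝ] ℝ) ≃ₗ[ℝ] _).toLinearMap ∘ₗ b)
  have h1 := T.hasFDerivWithinAt_of_bilinear hf.hasMFDerivAt.2 hh.hasMFDerivAt.2
  have hcont : ContinuousAt (fun x => T (f x) (h x)) p :=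
    (T.continuous.continuousAt.comp hf.continuousAt).clm_apply hh.continuousAt
  have h2 : HasMFDerivAt 𝓘(ℝ, E) 𝓘(ℝ, ℝ) (fun x => b (f x) (h x)) p _ := ⟨hcont, h1⟩
  have h3 := congrArg (fun l : E →L[ℝ] ℝ => l u) h2.mfderiv
  refine Eq.trans h3 ?_
  refine (add_comm _ _).trans ?_
  simp only [writtenInExtChartAt, extChartAt_model_space_eq_id, PartialEquiv.refl_coe,
    Function.comp_apply, id, extChartAt_to_inv]
  rfl

/-- The derivative of a vector field on a Lie group in the global frame of left-invariant vector
fields. -/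
def frameDeriv (σ : ∀ p : G, TangentSpace 𝓘(ℝ, E) p) (p : G) :
    TangentSpace 𝓘(ℝ, E) p →L[ℝ] GroupLieAlgebra 𝓘(ℝ, E) G :=
  mvfderiv 𝓘(ℝ, E) (F := E) (fun x => maurerCartan x (σ x)) p

variable [LieGroup 𝓘(ℝ, E) ∞ G] {σ τ : ∀ p : G, TangentSpace 𝓘(ℝ, E) p} {p : G}

theorem frameDeriv_add (hσ : MDiffAt (T% σ) p) (hτ : MDiffAt (T% τ) p) :
    frameDeriv (σ + τ) p = frameDeriv σ p + frameDeriv τ p := by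
  have h : (fun x => (maurerCartan x ((σ + τ) x) : GroupLieAlgebra 𝓘(ℝ, E) G)) =
      fun x => maurerCartan x (σ x) + maurerCartan x (τ x) := by
    ext x
    rw [Pi.add_apply, map_add]
  rw [frameDeriv, h]
  exact mvfderiv_add (mdifferentiableAt_maurerCartan hσ) (mdifferentiableAt_maurerCartan hτ)

theorem frameDeriv_smul {f : G → ℝ} (hσ : MDiffAt (T% σ) p)
    (hf : MDifferentiableAt 𝓘(ℝ, E) 𝓘(ℝ, ℝ) f p) :
    frameDeriv (f • σ) p = f p • frameDeriv σ p +
      (mvfderiv 𝓘(ℝ, E) f p).smulRight (maurerCartan p (σ p)) := by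
  have h : (fun x => (maurerCartan x ((f • σ) x) : GroupLieAlgebra 𝓘(ℝ, E) G)) =
      fun x => f x • maurerCartan x (σ x) := by
    ext x
    rw [Pi.smul_apply', map_smul]
  rw [frameDeriv, h]
  exact mvfderiv_smul hf (mdifferentiableAt_maurerCartan hσ)

theorem frameDeriv_mulInvariantVectorField (v : GroupLieAlgebra 𝓘(ℝ, E) G) :
    frameDeriv (mulInvariantVectorField v) p = 0 := by
  simp only [frameDeriv, maurerCartan_mulInvariantVectorField]
  exact mvfderiv_const (F := E) v

variable [FiniteDimensional ℝ E] (q : LinearMap.BilinForm ℝ (GroupLieAlgebra 𝓘(ℝ, E) G))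
  (hq : q.Nondegenerate)

/-- The Levi-Civita connection of a left-invariant metric. -/
def leviCivita : CovariantDerivative 𝓘(ℝ, E) E (TangentSpace 𝓘(ℝ, E) : G → Type _) where
  -- In the left-invariant frame, the connection is the ordinary derivative plus the constant
  -- Christoffel term `koszul`.
  toFun σ p := leftTranslation p ∘L (frameDeriv σ p +
    LinearMap.toContinuousLinearMap ((koszul q hq).flip (maurerCartan p (σ p))) ∘L
      maurerCartan p)
  isCovariantDerivativeOnUniv :=
    { add := fun {σ σ' x} hσ hσ' _ => by
        ext u
        simp [frameDeriv_add hσ hσ']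
        abel
      leibniz := fun {σ f x} hσ hf _ => by
        ext u
        simp [frameDeriv_smul hσ hf, leftTranslation_apply, mulInvariantVectorField_maurerCartan]
        abel }

theorem leviCivita_apply (u : TangentSpace 𝓘(ℝ, E) p) :
    leviCivita q hq σ p u = mulInvariantVectorField
      (frameDeriv σ p u + koszul q hq (maurerCartan p u) (maurerCartan p (σ p))) p := rfl

theorem leviCivita_mulInvariantVectorField (v w : GroupLieAlgebra 𝓘(ℝ, E) G) :
    leviCivita q hq (mulInvariantVectorField w) p (mulInvariantVectorField v p) =
      mulInvariantVectorField (koszul q hq v w) p := by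
  rw [leviCivita_apply, frameDeriv_mulInvariantVectorField, maurerCartan_mulInvariantVectorField,
    maurerCartan_mulInvariantVectorField, zero_apply, zero_add]

theorem mlieBracket_mulInvariantVectorField (v w : GroupLieAlgebra 𝓘(ℝ, E) G) :
    VectorField.mlieBracket 𝓘(ℝ, E) (mulInvariantVectorField v) (mulInvariantVectorField w) p =
      mulInvariantVectorField ⁅v, w⁆ p := by
  have := FiniteDimensional.complete ℝ E
  rw [GroupLieAlgebra.bracket_def, mulInvariantVector_mlieBracket]

/-- Torsion is a tensor, so it is enough to evaluate it on left-invariant fields through the given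
vectors. -/
theorem leviCivita_torsion : (leviCivita q hq).torsion = 0 := by
  have := FiniteDimensional.complete ℝ E
  ext p u w
  rw [← mulInvariantVectorField_maurerCartan p u, ← mulInvariantVectorField_maurerCartan p w,
    CovariantDerivative.torsion_apply _ (mdifferentiableAt_mulInvariantVectorField _)
      (mdifferentiableAt_mulInvariantVectorField _), leviCivita_mulInvariantVectorField,
    leviCivita_mulInvariantVectorField, mlieBracket_mulInvariantVectorField,
    ← koszul_sub_koszul q hq]
  simp only [← leftTranslation_apply, map_sub, sub_self]
  rfl

theorem isLeviCivita_leviCivita (hs : q.IsSymm) :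
    IsLeviCivita (leftInvariantMetric q) (leviCivita q hq) where
  torsion_free σ τ p hσ hτ := by
    have := FiniteDimensional.complete ℝ E
    exact (CovariantDerivative.torsion_eq_zero_iff _).1 (leviCivita_torsion q hq) hσ hτ
  metric σ τ p u hσ hτ := by
    have h := mvfderiv_bilinear (E := E) q (mdifferentiableAt_maurerCartan hσ)
      (mdifferentiableAt_maurerCartan hτ) u
    refine h.trans ?_
    rw [leftInvariantMetric_apply, leftInvariantMetric_apply, leviCivita_apply, leviCivita_apply,
      maurerCartan_mulInvariantVectorField, maurerCartan_mulInvariantVectorField, map_add, map_add,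
      LinearMap.add_apply]
    have hk := apply_koszul_add q hq hs (maurerCartan p u) (maurerCartan p (σ p))
      (maurerCartan p (τ p))
    change q (frameDeriv σ p u) (maurerCartan p (τ p)) +
      q (maurerCartan p (σ p)) (frameDeriv τ p u) = _
    linarith

/-- The Koszul formula: a Levi-Civita connection of a left-invariant metric on the diagonal of
left-invariant vector fields. -/
theorem IsLeviCivita.apply_mulInvariantVectorField_self
    {D : CovariantDerivative 𝓘(ℝ, E) E (TangentSpace 𝓘(ℝ, E) : G → Type _)}
    (hD : IsLeviCivita (leftInvariantMetric q) D) (hs : q.IsSymm)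
    (v : GroupLieAlgebra 𝓘(ℝ, E) G) :
    D (mulInvariantVectorField v) p (mulInvariantVectorField v p) =
      -mulInvariantVectorField (geodesicField q hq v) p := by
  have hd : ∀ w : GroupLieAlgebra 𝓘(ℝ, E) G, MDiffAt (T% (mulInvariantVectorField w)) p :=
    fun w => mdifferentiableAt_mulInvariantVectorField w
  have hm : ∀ u w x : GroupLieAlgebra 𝓘(ℝ, E) G,
      q (maurerCartan p (D (mulInvariantVectorField u) p (mulInvariantVectorField x p))) w +
        q u (maurerCartan p (D (mulInvariantVectorField w) p (mulInvariantVectorField x p))) = 0 :=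
    fun u w x => by
      have h := hD.metric (mulInvariantVectorField u) (mulInvariantVectorField w) p
        (mulInvariantVectorField x p) (hd u) (hd w)
      simp only [leftInvariantMetric_apply, maurerCartan_mulInvariantVectorField] at h
      rw [mvfderiv_const] at h
      exact h.symm
  have ht : ∀ w : GroupLieAlgebra 𝓘(ℝ, E) G,
      maurerCartan p (D (mulInvariantVectorField w) p (mulInvariantVectorField v p)) -
        maurerCartan p (D (mulInvariantVectorField v) p (mulInvariantVectorField w p)) = ⁅v, w⁆ :=
    fun w => by
      rw [← map_sub, hD.torsion_free _ _ p (hd v) (hd w), mlieBracket_mulInvariantVectorField,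
        maurerCartan_mulInvariantVectorField]
  have key : maurerCartan p (D (mulInvariantVectorField v) p (mulInvariantVectorField v p)) =
      -geodesicField q hq v := by
    refine hq.eq_of_forall_left fun w => ?_
    rw [map_neg, LinearMap.neg_apply, apply_geodesicField, ← ht w, map_sub]
    -- `q(∇_v v, w) = -q(v, ∇_v w)`, and `q(v, ∇_w v) = 0` since `q(v, v)` is constant;
    -- torsion-freeness then leaves `-q(v, [v, w])`.
    have h1 := hm v w v
    have h2 := hm v v w
    rw [hs.eq v] at h2
    rw [hs.eq v (maurerCartan p (D (mulInvariantVectorField v) p (mulInvariantVectorField w p)))]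
    linarith
  rw [← mulInvariantVectorField_maurerCartan p
    (D (mulInvariantVectorField v) p (mulInvariantVectorField v p)), key]
  simp only [← leftTranslation_apply, map_neg]

end LeviCivita

/-! ### Development of curves from the Lie algebra to the group. -/

section Development

variable {E : Type*} [NormedAddCommGroup E] [NormedSpace ℝ E]
  {G : Type*} [TopologicalSpace G] [ChartedSpace E G] [Group G]

/-- The vector field on `G × ℝ` whose integral curves are the graphs of the curves in `G` with
velocity `v t`, read in the frame of left-invariant vector fields. -/
def developmentField (v : ℝ → GroupLieAlgebra 𝓘(ℝ, E) G) (z : G × ℝ) :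
    TangentSpace (𝓘(ℝ, E).prod 𝓘(ℝ, ℝ)) z :=
  ((mulInvariantVectorField (v z.2) z.1, (1 : ℝ)) : TangentSpace 𝓘(ℝ, E) z.1 × ℝ)

variable [LieGroup 𝓘(ℝ, E) ∞ G] {v : ℝ → GroupLieAlgebra 𝓘(ℝ, E) G}

theorem contMDiff_developmentField (hv : ContDiff ℝ 1 (F := E) v) :
    ContMDiff (𝓘(ℝ, E).prod 𝓘(ℝ, ℝ)) (𝓘(ℝ, E).prod 𝓘(ℝ, ℝ)).tangent 1
      (fun z => (⟨z, developmentField v z⟩ :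
        TangentBundle (𝓘(ℝ, E).prod 𝓘(ℝ, ℝ)) (G × ℝ))) := by
  have h0 : ContMDiff 𝓘(ℝ, E) 𝓘(ℝ, E).tangent 1
      (fun x : G => (⟨x, (0 : E)⟩ : TangentBundle 𝓘(ℝ, E) G)) :=
    Bundle.contMDiff_zeroSection ℝ (TangentSpace 𝓘(ℝ, E) : G → Type _)
  have h1 : ContMDiff 𝓘(ℝ, ℝ) 𝓘(ℝ, E).tangent 1
      (fun t : ℝ => (⟨1, v t⟩ : TangentBundle 𝓘(ℝ, E) G)) := by
    intro t
    rw [Bundle.contMDiffAt_totalSpace]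
    refine ⟨contMDiffAt_const, ?_⟩
    refine (hv.contMDiff t).congr_of_eventuallyEq (Filter.Eventually.of_forall fun s => ?_)
    exact tangentBundle_trivializationAt_self 1 _
  have h2 : ContMDiff 𝓘(ℝ, ℝ) 𝓘(ℝ, ℝ).tangent 1
      (fun t : ℝ => (⟨t, (1 : ℝ)⟩ : TangentBundle 𝓘(ℝ, ℝ) ℝ)) :=
    contMDiff_vectorSpace_iff_contDiff.2 contDiff_const
  have h3 := (contMDiff_tangentMap_mul (E := E) (G := G)).comp
    ((contMDiff_equivTangentBundleProd_symm (I := 𝓘(ℝ, E)) (M := G) (I' := 𝓘(ℝ, E))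
      (M' := G) (n := 1)).comp ((h0.comp (contMDiff_fst (I := 𝓘(ℝ, E)) (J := 𝓘(ℝ, ℝ))
        (M := G) (N := ℝ))).prodMk (h1.comp contMDiff_snd)))
  have h4 : ContMDiff (𝓘(ℝ, E).prod 𝓘(ℝ, ℝ)) 𝓘(ℝ, E).tangent 1
      (fun z : G × ℝ =>
        (⟨z.1, mulInvariantVectorField (v z.2) z.1⟩ : TangentBundle 𝓘(ℝ, E) G)) := by
    refine h3.congr fun z => ?_
    refine (tangentBundle_mk_eq (mul_one z.1).symm _).trans ?_
    exact congrArg (Bundle.TotalSpace.mk (z.1 * 1))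
      (mfderiv_mul_apply_zero_left (E := E) z.1 1 (v z.2)).symm
  exact (contMDiff_equivTangentBundleProd_symm (I := 𝓘(ℝ, E)) (M := G) (I' := 𝓘(ℝ, ℝ))
      (M' := ℝ) (n := 1)).comp (h4.prodMk (h2.comp contMDiff_snd))

variable {Γ : ℝ → G × ℝ} {J : Set ℝ}

theorem IsMIntegralCurveOn.hasMFDerivWithinAt_fst (hΓ : IsMIntegralCurveOn Γ (developmentField v) J)
    {t : ℝ} (ht : t ∈ J) :
    HasMFDerivWithinAt 𝓘(ℝ, ℝ) 𝓘(ℝ, E) (fun t => (Γ t).1) J t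
      ((1 : ℝ →L[ℝ] ℝ).smulRight (mulInvariantVectorField (v (Γ t).2) (Γ t).1)) :=
  (hasMFDerivAt_fst (Γ t)).comp_hasMFDerivWithinAt t (hΓ t ht)

theorem IsMIntegralCurveOn.hasDerivWithinAt_snd (hΓ : IsMIntegralCurveOn Γ (developmentField v) J)
    {t : ℝ} (ht : t ∈ J) : HasDerivWithinAt (fun t => (Γ t).2) 1 J t := by
  have h := (hasMFDerivAt_snd (I := 𝓘(ℝ, E)) (I' := 𝓘(ℝ, ℝ)) (Γ t)).comp_hasMFDerivWithinAt t
    (hΓ t ht)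
  rw [hasDerivWithinAt_iff_hasFDerivWithinAt]
  exact (hasMFDerivWithinAt_iff_hasFDerivWithinAt.1 h)

theorem IsMIntegralCurveOn.snd_eq (hJ : J.OrdConnected)
    (hΓ : IsMIntegralCurveOn Γ (developmentField v) J) {t₀ : ℝ} (ht₀ : t₀ ∈ J)
    (h₀ : (Γ t₀).2 = t₀) {t : ℝ} (ht : t ∈ J) : (Γ t).2 = t := by
  have := eqOn_const_of_hasDerivWithinAt_zero (f := fun t => (Γ t).2 - t) hJ (fun s hs => by
    have := (hΓ.hasDerivWithinAt_snd hs).sub (hasDerivWithinAt_id s J)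
    rwa [sub_self] at this) ht ht₀
  simp only [h₀, sub_self] at this
  linarith

/-- The field is invariant under left translation of the group factor; this is the source of uniform
existence times. -/
theorem IsMIntegralCurveOn.mul_left (hΓ : IsMIntegralCurveOn Γ (developmentField v) J) (a : G) :
    IsMIntegralCurveOn (fun t => (a * (Γ t).1, (Γ t).2)) (developmentField v) J := by
  intro t ht
  have h1 := (mdifferentiableAt_leftMul (E := E) (a := a)
    (b := (Γ t).1)).hasMFDerivAt.comp_hasMFDerivWithinAt t (hΓ.hasMFDerivWithinAt_fst ht)
  have h2 := (hasMFDerivAt_snd (I := 𝓘(ℝ, E)) (I' := 𝓘(ℝ, ℝ)) (Γ t)).comp_hasMFDerivWithinAt t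
    (hΓ t ht)
  refine (h1.prodMk h2).congr_mfderiv ?_
  ext
  · change mfderiv 𝓘(ℝ, E) 𝓘(ℝ, E) (fun x : G => a * x) (Γ t).1
      ((1 : ℝ) • mulInvariantVectorField (v (Γ t).2) (Γ t).1) =
        (1 : ℝ) • mulInvariantVectorField (v (Γ t).2) (a * (Γ t).1)
    rw [one_smul, one_smul, mfderiv_mul_left_mulInvariantVectorField]
  · rfl

variable [T2Space G] [CompleteSpace E]

/-- By left translation, the time of existence of integral curves of `developmentField` is uniform
with respect to the initial point in the group. -/
theorem exists_isMIntegralCurveOn_developmentField (hv : ContDiff ℝ 1 (F := E) v) (s : ℝ) :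
    ∃ ε > 0, ∀ t ∈ Set.Ioo (s - ε) (s + ε), ∀ a : G, ∃ Γ : ℝ → G × ℝ, Γ t = (a, t) ∧
      IsMIntegralCurveOn Γ (developmentField v) (Set.Ioo (s - ε) (s + ε)) := by
  obtain ⟨Γ, hΓs, hΓ⟩ := exists_isMIntegralCurveAt_of_contMDiffAt_boundaryless
    (t₀ := s) ((contMDiff_developmentField hv) ((1 : G), s))
  rw [isMIntegralCurveAt_iff'] at hΓ
  obtain ⟨ε, hε, hΓ⟩ := hΓ
  rw [Real.ball_eq_Ioo] at hΓ
  -- One local solution through `(1, s)` suffices: translating it by `a * (Γ t).1⁻¹` makes it pass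
  -- through `(a, t)`.
  refine ⟨ε, hε, fun t ht a => ⟨_, ?_, hΓ.mul_left (a * ((Γ t).1)⁻¹)⟩⟩
  rw [inv_mul_cancel_right, hΓ.snd_eq Set.ordConnected_Ioo (t₀ := s)
    ⟨by linarith, by linarith⟩ (by rw [hΓs]) ht]

/-- If the half-lengths of the existence intervals had a finite supremum `A`, the uniform existence
times near `A` and `-A` would extend a nearly maximal solution past both ends. -/
theorem exists_isMIntegralCurveOn_developmentField_Ioo (hv : ContDiff ℝ 1 (F := E) v) (p : G)
    (T : ℝ) : ∃ Γ : ℝ → G × ℝ, Γ 0 = (p, 0) ∧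
      IsMIntegralCurveOn Γ (developmentField v) (Set.Ioo (-T) T) := by
  let S := {a : ℝ | ∃ Γ : ℝ → G × ℝ, Γ 0 = (p, 0) ∧
    IsMIntegralCurveOn Γ (developmentField v) (Set.Ioo (-a) a)}
  have hX := contMDiff_developmentField hv
  suffices hbdd : ¬ BddAbove S by
    obtain ⟨a, ⟨Γ, h0, hΓ⟩, hlt⟩ := not_bddAbove_iff.1 hbdd T
    exact ⟨Γ, h0, hΓ.mono (Set.Ioo_subset_Ioo (neg_le_neg hlt.le) hlt.le)⟩
  intro hbdd
  obtain ⟨A, hA⟩ : ∃ A, A = sSup S := ⟨_, rfl⟩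
  obtain ⟨ε₀, hε₀, h₀⟩ := exists_isMIntegralCurveOn_developmentField hv 0
  have hmem₀ : ε₀ ∈ S := by
    obtain ⟨Γ, hΓ0, hΓ⟩ := h₀ 0 ⟨by linarith, by linarith⟩ p
    rw [zero_sub, zero_add] at hΓ
    exact ⟨Γ, hΓ0, hΓ⟩
  have hA0 : 0 < A := hε₀.trans_le (hA ▸ le_csSup hbdd hmem₀)
  obtain ⟨ε₁, hε₁, h₁⟩ := exists_isMIntegralCurveOn_developmentField hv A
  obtain ⟨ε₂, hε₂, h₂⟩ := exists_isMIntegralCurveOn_developmentField hv (-A)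
  obtain ⟨ε, hε⟩ : ∃ ε, ε = min ε₁ ε₂ := ⟨_, rfl⟩
  have hε0 : 0 < ε := hε ▸ lt_min hε₁ hε₂
  have hεε₁ : ε ≤ ε₁ := hε ▸ min_le_left _ _
  have hεε₂ : ε ≤ ε₂ := hε ▸ min_le_right _ _
  obtain ⟨a, ha, hlt⟩ := exists_lt_of_lt_csSup ⟨ε₀, hmem₀⟩
    (show max (A - ε) 0 < sSup S by rw [← hA]; exact max_lt (by linarith) hA0)
  have haA : a ≤ A := hA ▸ le_csSup hbdd ha
  -- The gluing times `t₁` and `-t₁` lie in the domain of `Γ` and within `ε` of `A` and `-A`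
  -- respectively.
  obtain ⟨t₁, ht₁, ht₁a⟩ := exists_between hlt
  obtain ⟨ht₁A, ht₁0⟩ := max_lt_iff.1 ht₁
  obtain ⟨Γ, hΓ0, hΓ⟩ := ha
  have ha0 : (0 : ℝ) ∈ Set.Ioo (-a) a := ⟨by linarith, by linarith⟩
  have hsnd : ∀ t ∈ Set.Ioo (-a) a, Γ t = ((Γ t).1, t) := fun t ht =>
    Prod.ext rfl (hΓ.snd_eq Set.ordConnected_Ioo ha0 (by rw [hΓ0]) ht)
  have hm₁ : t₁ ∈ Set.Ioo (-a) a := ⟨by linarith, ht₁a⟩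
  have hm₂ : -t₁ ∈ Set.Ioo (-a) a := ⟨by linarith, by linarith⟩
  have hr : t₁ ∈ Set.Ioo (A - ε₁) (A + ε₁) := ⟨by linarith, by linarith⟩
  have hl : -t₁ ∈ Set.Ioo (-A - ε₂) (-A + ε₂) := ⟨by linarith, by linarith⟩
  obtain ⟨Γ₁, hΓ₁t, hΓ₁⟩ := h₁ t₁ hr (Γ t₁).1
  obtain ⟨Γ₂, hΓ₂t, hΓ₂⟩ := h₂ (-t₁) hl (Γ (-t₁)).1
  have hglue := (isMIntegralCurveOn_piecewise hX hΓ hΓ₁ ⟨hm₁, hr⟩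
    ((hsnd t₁ hm₁).trans hΓ₁t.symm)).mono (s' := Set.Ioo (-a) (A + ε))
    ((Set.Ioo_subset_Ioo le_rfl (by linarith)).trans
      (Set.Ioo_subset_Ioo_union_Ioo (b := a) (c := A - ε₁) (d := A + ε₁) le_rfl (by linarith)
        le_rfl))
  have hpw : ∀ t ∈ Set.Ioo (-a) a, (Set.Ioo (-a) a).piecewise Γ Γ₁ t = Γ t :=
    fun t ht => Set.piecewise_eq_of_mem _ _ _ ht
  have hm₂' : -t₁ ∈ Set.Ioo (-a) (A + ε) := ⟨hm₂.1, by linarith⟩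
  have hglue₂ := (isMIntegralCurveOn_piecewise hX hglue hΓ₂ ⟨hm₂', hl⟩
    ((hpw _ hm₂).trans ((hsnd _ hm₂).trans hΓ₂t.symm))).mono
      (s' := Set.Ioo (-(A + ε)) (A + ε)) (by
        rw [Set.union_comm]
        exact (Set.Ioo_subset_Ioo (by linarith) le_rfl).trans
          (Set.Ioo_subset_Ioo_union_Ioo (a := -A - ε₂) (b := -A + ε₂) (c := -a) le_rfl
            (by linarith) le_rfl))
  have : A + ε ∈ S := by
    refine ⟨_, ?_, hglue₂⟩
    rw [Set.piecewise_eq_of_mem _ _ _ (show (0 : ℝ) ∈ Set.Ioo (-a) (A + ε) from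
      ⟨ha0.1, by linarith⟩), hpw _ ha0, hΓ0]
  have := le_csSup hbdd this
  rw [← hA] at this
  linarith

/-- A curve in the Lie algebra is the velocity, read in the frame of left-invariant vector fields,
of a curve in the Lie group. -/
theorem exists_hasMFDerivAt_mulInvariantVectorField (hv : ContDiff ℝ 1 (F := E) v) (p : G) :
    ∃ γ : ℝ → G, γ 0 = p ∧ ∀ t, HasMFDerivAt 𝓘(ℝ, ℝ) 𝓘(ℝ, E) γ t
      ((1 : ℝ →L[ℝ] ℝ).smulRight (mulInvariantVectorField (v t) (γ t))) := by
  obtain ⟨Γ, hΓ0, hΓ⟩ := (exists_isMIntegralCurve_iff_exists_isMIntegralCurveOn_Ioo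
    (contMDiff_developmentField hv) (p, 0)).2
      (exists_isMIntegralCurveOn_developmentField_Ioo hv p)
  refine ⟨fun t => (Γ t).1, congrArg Prod.fst hΓ0, fun t => ?_⟩
  have h := (hΓ.isMIntegralCurveOn Set.univ)
  have h1 := h.hasMFDerivWithinAt_fst (Set.mem_univ t)
  rw [h.snd_eq Set.ordConnected_univ (Set.mem_univ 0) (by rw [hΓ0]) (Set.mem_univ t)] at h1
  exact hasMFDerivWithinAt_univ.1 h1

end Development

/-! ### Geodesic completeness as completeness of the geodesic field. -/

section Completeness

variable {E : Type*} [NormedAddCommGroup E] [NormedSpace ℝ E] [FiniteDimensional ℝ E]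
  {G : Type*} [TopologicalSpace G] [ChartedSpace E G] [Group G]
  [LieGroup 𝓘(ℝ, E) ∞ G] {q : LinearMap.BilinForm ℝ (GroupLieAlgebra 𝓘(ℝ, E) G)}

/-- The velocity of a geodesic, read in the frame of left-invariant vector fields, is an integral
curve of the geodesic field. -/
theorem IsGeodesic.exists_hasDerivAt (hs : q.IsSymm) (hq : q.Nondegenerate) {γ : ℝ → G}
    (hγ : IsGeodesic (leftInvariantMetric q) γ) {p : G} {u : TangentSpace 𝓘(ℝ, E) p}
    (hp : γ 0 = p)
    (hu : HasMFDerivAt 𝓘(ℝ, ℝ) 𝓘(ℝ, E) γ 0 ((1 : ℝ →L[ℝ] ℝ).smulRight u)) :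
    ∃ v : ℝ → GroupLieAlgebra 𝓘(ℝ, E) G, v 0 = maurerCartan p u ∧
      ∀ t, HasDerivAt v (geodesicField q hq (v t)) t := by
  subst hp
  obtain ⟨D, hD, v, v', h⟩ := hγ
  refine ⟨v, ?_, fun t => ?_⟩
  · have h1 := congrArg (fun l : ℝ →L[ℝ] E => l 1) (hasMFDerivAt_unique (h 0).1 hu)
    have h2 : mulInvariantVectorField (v 0) (γ 0) = u :=
      ((one_smul ℝ _).symm.trans h1).trans (one_smul ℝ _)
    rw [← h2, maurerCartan_mulInvariantVectorField]
  · obtain ⟨-, h1, h2⟩ := h t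
    rw [hD.apply_mulInvariantVectorField_self q hq hs] at h2
    have h3 := congrArg (maurerCartan (γ t)) h2
    rw [map_add, map_neg, maurerCartan_mulInvariantVectorField,
      maurerCartan_mulInvariantVectorField, map_zero, add_neg_eq_zero] at h3
    rwa [h3] at h1

theorem LinearMap.continuous_apply_self {V : Type*} [NormedAddCommGroup V] [NormedSpace ℝ V]
    [FiniteDimensional ℝ V] (T : V →ₗ[ℝ] V →ₗ[ℝ] V) : Continuous fun x => T x x := by
  let T' : V →ₗ[ℝ] V →L[ℝ] V :=
    (LinearMap.toContinuousLinearMap : (V →ₗ[ℝ] V) ≃ₗ[ℝ] _).toLinearMap ∘ₗ T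
  exact (LinearMap.toContinuousLinearMap T').continuous.clm_apply continuous_id

theorem contDiff_one_of_hasDerivAt {V : Type*} [NormedAddCommGroup V] [NormedSpace ℝ V]
    {v w : ℝ → V} (hv : ∀ t, HasDerivAt v (w t) t) (hw : Continuous w) : ContDiff ℝ 1 v := by
  rw [contDiff_one_iff_deriv]
  refine ⟨fun t => (hv t).differentiableAt, ?_⟩
  rwa [funext fun t => (hv t).deriv]

/-- An integral curve of the geodesic field is the velocity of a geodesic with given initial
point. -/
theorem exists_isGeodesic [T2Space G] (hs : q.IsSymm) (hq : q.Nondegenerate)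
    {v : ℝ → GroupLieAlgebra 𝓘(ℝ, E) G} (hv : ∀ t, HasDerivAt v (geodesicField q hq (v t)) t)
    {p : G} {u : TangentSpace 𝓘(ℝ, E) p} (hu : v 0 = maurerCartan p u) :
    ∃ γ : ℝ → G, IsGeodesic (leftInvariantMetric q) γ ∧ γ 0 = p ∧
      HasMFDerivAt 𝓘(ℝ, ℝ) 𝓘(ℝ, E) γ 0 ((1 : ℝ →L[ℝ] ℝ).smulRight u) := by
  have := FiniteDimensional.complete ℝ E
  have hcont : Continuous (Y := E) v :=
    continuous_iff_continuousAt.2 fun t => HasDerivAt.continuousAt (F := E) (hv t)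
  have hF := LinearMap.continuous_apply_self (V := E)
    (adTranspose (L := GroupLieAlgebra 𝓘(ℝ, E) G) q hq)
  have hv1 := contDiff_one_of_hasDerivAt (V := E) hv (hF.comp hcont)
  obtain ⟨γ, hγ0, hγ⟩ := exists_hasMFDerivAt_mulInvariantVectorField hv1 p
  refine ⟨γ, ⟨leviCivita q hq, isLeviCivita_leviCivita q hq hs, v,
    fun t => geodesicField q hq (v t), fun t => ⟨hγ t, hv t, ?_⟩⟩, hγ0, ?_⟩
  · rw [leviCivita_mulInvariantVectorField, koszul_self]
    simp only [← leftTranslation_apply, map_neg, add_neg_cancel]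
  · subst hγ0
    have h := hγ 0
    rwa [hu, mulInvariantVectorField_maurerCartan] at h

/-- Geodesics from the identity already realize every initial value in the Lie algebra. Conversely,
developing a global solution from `p` gives a global geodesic. -/
theorem isGeodesicallyComplete_leftInvariantMetric_iff [T2Space G] (hs : q.IsSymm)
    (hq : q.Nondegenerate) :
    IsGeodesicallyComplete (G := G) (leftInvariantMetric q) ↔
      ∀ x : GroupLieAlgebra 𝓘(ℝ, E) G, ∃ v : ℝ → GroupLieAlgebra 𝓘(ℝ, E) G, v 0 = x ∧
        ∀ t, HasDerivAt v (geodesicField q hq (v t)) t := by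
  constructor
  · intro h x
    obtain ⟨γ, hγ, hγ0, hu⟩ := h 1 (mulInvariantVectorField x 1)
    obtain ⟨v, hv0, hv⟩ := hγ.exists_hasDerivAt hs hq hγ0 hu
    exact ⟨v, by rw [hv0, maurerCartan_mulInvariantVectorField], hv⟩
  · intro h p u
    obtain ⟨v, hv0, hv⟩ := h (maurerCartan p u)
    exact exists_isGeodesic hs hq hv hv0

/-- Completeness of a left-invariant metric on a Lie group with Lie algebra `aff(ℝ) ⊕ ℝ`, in terms
of the geodesic field on `aff(ℝ) ⊕ ℝ`. -/
theorem isGeodesicallyComplete_iff_of_lieEquiv [T2Space G]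
    (e : GroupLieAlgebra 𝓘(ℝ, E) G ≃ₗ⁅ℝ⁆ AffRSumR) {q : LinearMap.BilinForm ℝ AffRSumR}
    (hs : q.IsSymm) (hq : q.Nondegenerate) :
    IsGeodesicallyComplete (G := G) (leftInvariantMetric
      (q.comp (e : GroupLieAlgebra 𝓘(ℝ, E) G →ₗ[ℝ] AffRSumR)
        (e : GroupLieAlgebra 𝓘(ℝ, E) G →ₗ[ℝ] AffRSumR))) ↔
      ∀ x, ∃ v : ℝ → AffRSumR, v 0 = x ∧ IsIntegralCurve v (fun _ => geodesicField q hq) := by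
  let q' : LinearMap.BilinForm ℝ (GroupLieAlgebra 𝓘(ℝ, E) G) :=
    q.comp (e : GroupLieAlgebra 𝓘(ℝ, E) G →ₗ[ℝ] AffRSumR)
      (e : GroupLieAlgebra 𝓘(ℝ, E) G →ₗ[ℝ] AffRSumR)
  have hqe : ∀ x y, q' x y = q (e x) (e y) := fun _ _ => rfl
  have hs' : q'.IsSymm := ⟨fun x y => hs.eq _ _⟩
  have hq' : q'.Nondegenerate := by
    have key : ∀ x, (∀ y, q' x y = 0) → x = 0 := fun x hx => by
      refine e.injective ((hq.1 (e x) fun w => ?_).trans (map_zero e).symm)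
      obtain ⟨y, rfl⟩ : ∃ y, e y = w := e.surjective w
      exact hx y
    exact ⟨key, fun x hx => key x fun y => (hs'.eq x y).trans (hx y)⟩
  have hF := geodesicField_comp e q hq q' hq' hqe
  refine (isGeodesicallyComplete_leftInvariantMetric_iff hs' hq').trans ⟨fun h x => ?_, fun h x => ?_⟩
  · obtain ⟨v, hv0, hv⟩ := h (e.symm x)
    refine ⟨fun t => e (v t), by simp [hv0], fun t => ?_⟩
    have h1 := HasDerivAt.linearMap_comp (V := E)
      (e : GroupLieAlgebra 𝓘(ℝ, E) G →ₗ[ℝ] AffRSumR) (hv t)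
    exact h1.congr_deriv (hF (v t))
  · obtain ⟨v, hv0, hv⟩ := h (e x)
    refine ⟨fun t => e.symm (v t), by simp [hv0], fun t => ?_⟩
    have h1 := HasDerivAt.linearMap_comp (W := E)
      (e.symm : AffRSumR →ₗ[ℝ] GroupLieAlgebra 𝓘(ℝ, E) G) (hv t)
    refine HasDerivAt.congr_deriv (F := E) h1 ?_
    refine e.injective ?_
    change e (e.symm (geodesicField q hq (v t))) = e (geodesicField q' hq' (e.symm (v t)))
    rw [hF, e.apply_symm_apply, e.apply_symm_apply]

end Completeness

end

/-! ### The four cases. -/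

theorem theorem1p1
    {E : Type*} [NormedAddCommGroup E] [NormedSpace ℝ E] [FiniteDimensional ℝ E]
    {G : Type*} [TopologicalSpace G] [T2Space G] [ChartedSpace E G] [Group G]
    [LieGroup 𝓘(ℝ, E) ∞ G]
    (e : GroupLieAlgebra 𝓘(ℝ, E) G ≃ₗ⁅ℝ⁆ AffRSumR)
    (q : LinearMap.BilinForm ℝ AffRSumR) (hq : IsLorentzian q)
    (z d : LieIdeal ℝ AffRSumR) (hz : z = LieAlgebra.center ℝ AffRSumR)
    (hd : d = LieAlgebra.derivedSeries ℝ AffRSumR 1)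
    (g : ∀ p : G, TangentSpace 𝓘(ℝ, E) p → TangentSpace 𝓘(ℝ, E) p → ℝ)
    (hg : g = leftInvariantMetric
      (q.comp (e : GroupLieAlgebra 𝓘(ℝ, E) G →ₗ[ℝ] AffRSumR)
        (e : GroupLieAlgebra 𝓘(ℝ, E) G →ₗ[ℝ] AffRSumR)))
    (F : AffRSumR → AffRSumR) (hF : F = geodesicField q hq.nondegenerate) :
    (IsSpacelike q z.toSubmodule →
      ¬ IsGeodesicallyComplete g ∧ ∃ v, IsIdempotentOf F v) ∧
    (IsTimelike q z.toSubmodule →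
      IsGeodesicallyComplete g ∧
        ∀ v J, IsIntegralCurveOnInterval F v J → Bornology.IsBounded (v '' J)) ∧
    (IsLightlike q z.toSubmodule → ¬ AreOrthogonal q z.toSubmodule d.toSubmodule →
      ¬ IsGeodesicallyComplete g ∧ ¬ ∃ v, IsIdempotentOf F v) ∧
    (IsLightlike q z.toSubmodule → AreOrthogonal q z.toSubmodule d.toSubmodule →
      IsGeodesicallyComplete g ∧
        ∀ v J, IsMaximalIntegralCurve F v J → ¬ IsStationaryOn v J →
          ¬ Bornology.IsBounded (v '' J)) := by
  have hs := hq.isSymm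
  have hn := hq.nondegenerate
  subst hz hd hg hF
  rw [isGeodesicallyComplete_iff_of_lieEquiv e hs hn]
  have hZ := AffRSumR.Z_mem_center
  have hB : AffRSumR.B ∈ (LieAlgebra.derivedSeries ℝ AffRSumR 1).toSubmodule := by
    rw [AffRSumR.derivedSeries_one_eq]
    exact Submodule.mem_span_singleton_self _
  refine ⟨fun h => ?_, fun h => ?_, fun h ho => ?_, fun h ho => ?_⟩
  · have hZZ := h _ hZ AffRSumR.Z_ne_zero
    exact ⟨AffRSumR.not_complete_of_spacelike hq hZZ,
      AffRSumR.exists_isIdempotentOf_geodesicField hq hZZ⟩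
  · have hZZ := h _ hZ AffRSumR.Z_ne_zero
    exact ⟨AffRSumR.complete_of_timelike hq hZZ,
      fun v J => AffRSumR.isBounded_of_timelike hq hZZ⟩
  · have hZB : q AffRSumR.Z AffRSumR.B ≠ 0 := by
      intro h0
      refine ho fun w hw w' hw' => ?_
      obtain ⟨c, rfl⟩ := AffRSumR.eq_smul_Z_of_mem_center hw
      rw [AffRSumR.derivedSeries_one_eq, Submodule.mem_span_singleton] at hw'
      obtain ⟨c', rfl⟩ := hw'
      simp [h0]
    exact ⟨AffRSumR.not_complete_of_lightlike_of_not_orthogonal hs hn (h _ hZ) hZB,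
      AffRSumR.not_exists_isIdempotentOf_geodesicField hs hn (h _ hZ) hZB⟩
  · have hZB := ho _ hZ _ hB
    exact ⟨fun x => ⟨_, AffRSumR.orthogonalCurve_zero x,
        AffRSumR.isIntegralCurve_orthogonalCurve hs hn (h _ hZ) hZB x⟩,
      fun v J => AffRSumR.not_isBounded_of_orthogonal hs hn (h _ hZ) hZB⟩
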